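/- For an integer $N\ge 2$, $1<p\le N$ and $0<R<\overline R$, consider the radial eigenvalue problem $$-\Delta_p u=\lambda|u|^{p-2}u \ \text{ in } R<|x|<\overline R\ (x\in\mathbb R^N),\qquad u=0 \ \text{ on } |x|=R \text{ and } |x|=\overline R, \qquad u \text{ radial},\ u\not\equiv 0,$$ where $\Delta_p u=\operatorname{div}(|\nabla u|^{p-2}\nabla u)$, and let $\lambda_k(R,\overline R)$ be its $k$-th eigenvalue ($k=1,2,\dots$) in increasing order. A change of the radial variable turns it into the problem $$(|v'|^{p-2}v')'+\lambda\, q(t)|v|^{p-2}v=0 \ \text{ in } (0,1),\qquad v(0)=v(1)=0,\qquad v\not\equiv0, \tag{1}$$ which has the same eigenvalues, with the weight $q=q_{R,\overline R}$ given by $$q(t)=\Bigl[R\Bigl(\tfrac{\overline R}{R}\Bigr)^t\ln\tfrac{\overline R}{R}\Bigr]^p \ \text{ if } p=N,\qquad q(t)=\Bigl(\frac{p-1}{N-p}\Bigr)^{p}\frac{A^{(p-1)p/(N-p)}}{(B-t)^{p(N-1)/(N-p)}}\ \text{ if } p<N,$$ where, with $s=\frac{N-p}{p-1}$, $A=\frac{(R\overline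 R)^s}{\overline R^s-R^s}$ and $B=\frac{\overline R^s}{\overline R^s-R^s}$. Put $$\bar q_-(R,\overline R)=\int_0^1\min\{1,q(t)\}\,dt,\qquad \bar q_+(R,\overline R)=\int_0^1\max\{1,q(t)\}\,dt,\qquad \pi_p=\frac{2\pi(p-1)^{1/p}}{p\sin(\pi/p)}.$$ (i) If $p=N\ge 2$, then $\lim_{R\to\infty}\bar q_+(R,R+1)=\lim_{R\to\infty}\bar q_-(R,R+1)=1$; moreover, for every $k\ge1$, $\lambda_k(R,R+1)$ exists for all $R>0$ and is also the $k$-th eigenvalue of (1) with $\overline R=R+1$, and $$\lim_{R\to\infty}\lambda_k(R,R+1)=(k\pi_p)^p,$$ which is the $k$-th eigenvalue of $(|v'|^{p-2}v')'+\lambda|v|^{p-2}v=0$ in $(0,1)$, $v(0)=v(1)=0$. (ii) If $p=2$ and $N\ge3$, then $\lim_{R\to\infty}\bar q_+(R,R+1)=\lim_{R\to\infty}\bar q_-(R,R+1)=1$; moreover, for every $k\ge1$, $\lambda_k(R,R+1)$ exists for all $R>0$ and is also the $k$-th eigenvalue of (1) with $\overline R=R+1$, and $$\lim_{R\to\infty}\lambda_k(R,R+1)=(k\pi)^2,$$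 which is the $k$-th eigenvalue of $v''+\lambda v=0$ in $(0,1)$, $v(0)=v(1)=0$. -/

import Mathlib

open Filter Topology

noncomputable section

namespace AnnularEigenvalues

/-- The `k`-th element (`k = 1, 2, 3, …`) of a set `S` of real numbers in increasing order: the
element of `S` that has exactly `k - 1` elements of `S` below it. -/
def IsKthSmallest (S : Set ℝ) (k : ℕ) (l : ℝ) : Prop :=
  l ∈ S ∧ {m | m ∈ S ∧ m < l}.encard + 1 = (k : ℕ∞)

/-- There is at most one `k`-th element. -/
theorem IsKthSmallest.unique {S : Set ℝ} {k : ℕ} {l l' : ℝ}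
    (h : IsKthSmallest S k l) (h' : IsKthSmallest S k l') : l = l' := by
  have key : ∀ a b : ℝ, IsKthSmallest S k a → IsKthSmallest S k b → ¬ a < b := by
    intro a b ha hb hab
    have hfin : {m | m ∈ S ∧ m < a}.Finite := by
      rw [← Set.encard_ne_top_iff]
      intro htop
      have h2 := ha.2
      rw [htop, top_add] at h2
      exact ENat.natCast_ne_top k h2.symm
    have hss : {m | m ∈ S ∧ m < a} ⊂ {m | m ∈ S ∧ m < b} :=
      ⟨fun m hm => ⟨hm.1, hm.2.trans hab⟩, fun hsub => lt_irrefl a (hsub ⟨ha.1, hab⟩).2⟩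
    have hlt := hfin.encard_lt_encard hss
    have heq : {m | m ∈ S ∧ m < a}.encard + 1 = {m | m ∈ S ∧ m < b}.encard + 1 :=
      ha.2.trans hb.2.symm
    rw [(ENat.add_left_injective_of_ne_top ENat.one_ne_top) heq] at hlt
    exact lt_irrefl _ hlt
  exact le_antisymm (not_lt.mp (key _ _ h' h)) (not_lt.mp (key _ _ h h'))

/-- The divergence `∑ i, ∂Vᵢ/∂xᵢ` of a vector field on `ℝ^N`. -/
def divergence {N : ℕ} (V : EuclideanSpace ℝ (Fin N) → EuclideanSpace ℝ (Fin N))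
    (x : EuclideanSpace ℝ (Fin N)) : ℝ :=
  ∑ i, (fderiv ℝ V x (EuclideanSpace.single i 1)) i

/-- The vector field `|∇u|^(p-2) ∇u`, whose divergence is the `p`-Laplacian of `u`. -/
def pFlux {N : ℕ} (p : ℝ) (u : EuclideanSpace ℝ (Fin N) → ℝ)
    (x : EuclideanSpace ℝ (Fin N)) : EuclideanSpace ℝ (Fin N) :=
  ‖gradient u x‖ ^ (p - 2) • gradient u x

/-- `Δ_p u = div (|∇u|^(p-2) ∇u)`. -/
def pLaplacian {N : ℕ} (p : ℝ) (u : EuclideanSpace ℝ (Fin N) → ℝ)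
    (x : EuclideanSpace ℝ (Fin N)) : ℝ :=
  divergence (pFlux p u) x

/-- `u` is a radial eigenfunction for the eigenvalue `l` of the Dirichlet problem
`-Δ_p u = l |u|^(p-2) u` in `R < |x| < R'`, `u = 0` for `|x| = R` and `|x| = R'`.
The function `u` is continuous up to the boundary, `u` and `|∇u|^(p-2) ∇u` are differentiable
inside, the equation holds at every point, and `u` is radial and not identically zero. -/
structure IsRadialEigenfunction (N : ℕ) (p R R' l : ℝ)
    (u : EuclideanSpace ℝ (Fin N) → ℝ) : Prop where
  continuousOn : ContinuousOn u {x | R ≤ ‖x‖ ∧ ‖x‖ ≤ R'}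
  differentiableAt : ∀ x, R < ‖x‖ → ‖x‖ < R' → DifferentiableAt ℝ u x
  differentiableAt_flux : ∀ x, R < ‖x‖ → ‖x‖ < R' → DifferentiableAt ℝ (pFlux p u) x
  equation : ∀ x, R < ‖x‖ → ‖x‖ < R' → -pLaplacian p u x = l * (|u x| ^ (p - 2) * u x)
  boundary : ∀ x, ‖x‖ = R ∨ ‖x‖ = R' → u x = 0
  radial : ∀ x y, R < ‖x‖ → ‖x‖ < R' → ‖x‖ = ‖y‖ → u x = u y
  nontrivial : ∃ x, R < ‖x‖ ∧ ‖x‖ < R' ∧ u x ≠ 0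

/-- The radial eigenvalues of the Dirichlet `p`-Laplacian in the annulus `R < |x| < R'`. -/
def radialSpectrum (N : ℕ) (p R R' : ℝ) : Set ℝ :=
  {l | ∃ u, IsRadialEigenfunction N p R R' l u}

/-- `v` is an eigenfunction for the eigenvalue `l` of the problem
`(|v'|^(p-2) v')' + l q |v|^(p-2) v = 0` in `(0, 1)`, `v 0 = v 1 = 0`. -/
structure IsWeightedEigenfunction (p : ℝ) (q : ℝ → ℝ) (l : ℝ) (v : ℝ → ℝ) : Prop where
  continuousOn : ContinuousOn v (Set.Icc 0 1)
  differentiableAt : ∀ t ∈ Set.Ioo (0 : ℝ) 1, DifferentiableAt ℝ v t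
  equation : ∀ t ∈ Set.Ioo (0 : ℝ) 1,
    HasDerivAt (fun s => |deriv v s| ^ (p - 2) * deriv v s)
      (-(l * q t * (|v t| ^ (p - 2) * v t))) t
  left : v 0 = 0
  right : v 1 = 0
  nontrivial : ∃ t ∈ Set.Ioo (0 : ℝ) 1, v t ≠ 0

/-- The eigenvalues of `(|v'|^(p-2) v')' + l q |v|^(p-2) v = 0`, `v 0 = v 1 = 0`. -/
def weightedSpectrum (p : ℝ) (q : ℝ → ℝ) : Set ℝ :=
  {l | ∃ v, IsWeightedEigenfunction p q l v}

/-- The constant `A` of the change of variables `t = -A r^(-(N-p)/(p-1)) + B` for `p < N`. -/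
def coeffA (N : ℕ) (p R R' : ℝ) : ℝ :=
  (R * R') ^ ((N - p) / (p - 1)) / (R' ^ ((N - p) / (p - 1)) - R ^ ((N - p) / (p - 1)))

/-- The constant `B` of the change of variables `t = -A r^(-(N-p)/(p-1)) + B` for `p < N`. -/
def coeffB (N : ℕ) (p R R' : ℝ) : ℝ :=
  R' ^ ((N - p) / (p - 1)) / (R' ^ ((N - p) / (p - 1)) - R ^ ((N - p) / (p - 1)))

open Classical in
/-- The transformed weight `q` on `[0, 1]`, for `1 < p ≤ N` and `0 < R < R'`. -/
def weight (N : ℕ) (p R R' t : ℝ) : ℝ :=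
  if p = N then (R * (R' / R) ^ t * Real.log (R' / R)) ^ p
  else ((p - 1) / (N - p)) ^ p *
    (coeffA N p R R' ^ ((p - 1) * p / (N - p)) /
      (coeffB N p R R' - t) ^ (p * (N - 1) / (N - p)))

/-- The averaged weight `q̄₋ = ∫₀¹ min {1, q}`. -/
def qMinus (N : ℕ) (p R R' : ℝ) : ℝ := ∫ t in (0 : ℝ)..1, min 1 (weight N p R R' t)

/-- The averaged weight `q̄₊ = ∫₀¹ max {1, q}`. -/
def qPlus (N : ℕ) (p R R' : ℝ) : ℝ := ∫ t in (0 : ℝ)..1, max 1 (weight N p R R' t)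

/-- `π_p = 2 π (p-1)^(1/p) / (p sin (π/p))`. -/
def piP (p : ℝ) : ℝ :=
  2 * Real.pi * (p - 1) ^ (1 / p) / (p * Real.sin (Real.pi / p))

end AnnularEigenvalues

end

/-!
Only exponents `p ≥ 2` occur, and for these a shooting argument in Prüfer coordinates determines
the whole spectrum of the weighted problem.

Let `S` be the generalized sine `pSin p`, which satisfies `|S|^p + |S'|^p = 1`, and `ϖ` its half
period. Write an eigenvalue as `(p - 1) μ^p`; nonpositive eigenvalues are excluded by integration
by parts (`IsWeightedEigenfunction.eigenvalue_pos`). In polar coordinates `μ v = r S(θ)`,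
`v' = r S'(θ)` the equation becomes `θ' = μ (1 + (q - 1) |S(θ)|^p)`, which does not involve `r`
and is Lipschitz in `θ`. Hence `(p - 1) μ^p` is an eigenvalue if and only if the solution with
`θ(0) = 0` ends at a multiple of `ϖ` (`isWeightedEigenfunction_of_isAngle`,
`IsWeightedEigenfunction.exists_isAngle`). The terminal angle is continuous and strictly
increasing in `μ`, and if `m ≤ q ≤ M` with `m ≤ 1 ≤ M`, it lies between `m μ` and `M μ`
(`AngleData.exists_parameter`). So for every `k ≥ 1` exactly one eigenvalue has terminal angle
`k ϖ`. It is the `k`-th one, and it lies between `(k π_p / M)^p` and `(k π_p / m)^p`, because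
`π_p = (p - 1)^(1/p) ϖ` by a Beta integral (`exists_eigenvalues`, `piP_eq`). For `q = 1` it equals
`(k π_p)^p`, and when `q` tends to `1` uniformly the `k`-th eigenvalue tends to that number.

The delicate point is that the map from `v'` to the flux `|v'|^(p-2) v'` has a non-Lipschitz
inverse, so uniqueness for the first-order system is not available from the general theory.
Instead every solution is shown to have a Prüfer angle: the energy `|μ v|^p + |v'|^p` satisfies a
linear differential inequality, so it never vanishes, and the direction of `(μ v, v')` lifts
through the covering `ℝ → Circle` (`exists_isAngle_of_system`). Uniqueness is then needed only for
the scalar angle equation.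

For radial functions the `p`-Laplacian is `r^(1-N) (r^(N-1) |U'|^(p-2) U')'`. A change of
variables `r = ρ(t)` with `ρ'^(p-1) = K ρ^(N-1)` turns the radial problem into the weighted one
with `q = ρ'^p`, so that the two spectra coincide (`RadialChange.radialSpectrum_eq`). In both
cases of the theorem `ρ'` is a constant times a power of `ρ`, and `R ≤ ρ ≤ R + 1` gives explicit
bounds for `q` that tend to `1` as `R → ∞`.
-/

noncomputable section

namespace AnnularEigenvalues

/-! ### Odd powers -/

/-- The odd power `x ↦ |x|^(e-1) x`, that is `sign x * |x|^e`. -/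
def oddPow (e x : ℝ) : ℝ := |x| ^ (e - 1) * x

@[simp] lemma oddPow_zero (e : ℝ) : oddPow e 0 = 0 := by simp [oddPow]

@[simp] lemma oddPow_one (x : ℝ) : oddPow 1 x = x := by simp [oddPow]

lemma oddPow_eq_zero {e x : ℝ} : oddPow e x = 0 ↔ x = 0 := by
  refine ⟨fun h => ?_, fun h => by simp [h]⟩
  by_contra hx
  have : 0 < |x| ^ (e - 1) := Real.rpow_pos_of_pos (abs_pos.2 hx) _
  rcases mul_eq_zero.1 h with h | h
  · exact this.ne' h
  · exact hx h

lemma abs_oddPow {e : ℝ} (he : e ≠ 0) (x : ℝ) : |oddPow e x| = |x| ^ e := by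
  rcases eq_or_ne x 0 with rfl | hx
  · simp [Real.zero_rpow he]
  · have h : 0 < |x| := abs_pos.2 hx
    rw [oddPow, abs_mul, abs_of_pos (Real.rpow_pos_of_pos h _), Real.rpow_sub_one h.ne']
    field_simp

lemma oddPow_mul_self {e : ℝ} (he : e + 1 ≠ 0) (x : ℝ) : oddPow e x * x = |x| ^ (e + 1) := by
  rcases eq_or_ne x 0 with rfl | hx
  · simp [Real.zero_rpow he]
  · have h : 0 < |x| := abs_pos.2 hx
    rw [oddPow, mul_assoc, ← abs_mul_abs_self, ← mul_assoc, ← Real.rpow_add_one h.ne',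
      ← Real.rpow_add_one h.ne']
    congr 1; ring

/-- For `e = 0` both sides are `oddPow 0 x`, the sign of `x`, so no hypothesis is needed. -/
lemma oddPow_oddPow (d e x : ℝ) : oddPow d (oddPow e x) = oddPow (e * d) x := by
  rcases eq_or_ne e 0 with rfl | he
  · rcases eq_or_ne x 0 with rfl | hx
    · simp
    · have h : 0 < |x| := abs_pos.2 hx
      have h1 : |oddPow 0 x| = 1 := by
        rw [oddPow, abs_mul, abs_of_pos (Real.rpow_pos_of_pos h _), zero_sub, Real.rpow_neg_one]
        field_simp
      rw [oddPow, h1]; simp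
  rcases eq_or_ne x 0 with rfl | hx
  · simp
  · have h : 0 < |x| := abs_pos.2 hx
    rw [oddPow, abs_oddPow he, oddPow, oddPow, ← mul_assoc, ← Real.rpow_mul h.le, ← Real.rpow_add h]
    congr 2; ring

lemma oddPow_mul (e x y : ℝ) : oddPow e (x * y) = oddPow e x * oddPow e y := by
  rw [oddPow, oddPow, oddPow, abs_mul, Real.mul_rpow (abs_nonneg _) (abs_nonneg _)]; ring

lemma oddPow_of_nonneg {e x : ℝ} (he : e ≠ 0) (hx : 0 ≤ x) : oddPow e x = x ^ e := by
  rw [← abs_of_nonneg hx, ← abs_oddPow he, abs_of_nonneg hx, abs_of_nonneg]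
  exact mul_nonneg (Real.rpow_nonneg (abs_nonneg _) _) hx

/-- At `x = 0` with `e = 1` the formula reads `1 * 0 ^ 0 = 1`, which is the correct value. -/
lemma hasDerivAt_oddPow {e x : ℝ} (h : x ≠ 0 ∨ 1 ≤ e) :
    HasDerivAt (oddPow e) (e * |x| ^ (e - 1)) x := by
  rcases eq_or_ne x 0 with rfl | hx
  · have he : 1 ≤ e := by simpa using h
    rcases he.eq_or_lt with rfl | he
    · simpa using (hasDerivAt_id (0 : ℝ)).congr_of_eventuallyEq
        (Eventually.of_forall fun x => oddPow_one x)
    · rw [abs_zero, Real.zero_rpow (by linarith), mul_zero, hasDerivAt_iff_tendsto_slope]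
      have hc : Tendsto (fun y : ℝ => |y| ^ (e - 1)) (𝓝[≠] 0) (𝓝 0) := by
        have : ContinuousAt (fun y : ℝ => |y| ^ (e - 1)) 0 :=
          (continuous_abs.rpow_const fun _ => Or.inr (by linarith)).continuousAt
        have h2 := this.tendsto
        simp only [abs_zero, Real.zero_rpow (show e - 1 ≠ 0 by linarith)] at h2
        exact h2.mono_left nhdsWithin_le_nhds
      refine hc.congr' ?_
      filter_upwards [self_mem_nhdsWithin] with y hy
      have hy : y ≠ 0 := hy
      simp [slope, oddPow]
      field_simp
  · have hpos : 0 < |x| := abs_pos.2 hx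
    have h1 : HasDerivAt (oddPow e)
        ((SignType.sign x : ℝ) * (e - 1) * |x| ^ (e - 1 - 1) * x + |x| ^ (e - 1) * 1) x :=
      ((hasDerivAt_abs hx).rpow_const (Or.inl hpos.ne')).mul (hasDerivAt_id x)
    refine h1.congr_deriv ?_
    have : (SignType.sign x : ℝ) * x = |x| := sign_mul_self x
    rw [Real.rpow_sub_one hpos.ne' (e - 1)]
    field_simp
    linear_combination (e - 1) * this

lemma continuous_oddPow {e : ℝ} (he : 0 < e) : Continuous (oddPow e) := by
  rw [continuous_iff_continuousAt]
  intro x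
  rcases eq_or_ne x 0 with rfl | hx
  · rw [ContinuousAt, oddPow_zero, tendsto_zero_iff_abs_tendsto_zero]
    have h2 := ((continuous_abs.rpow_const fun _ => Or.inr he.le : Continuous
      (fun y : ℝ => |y| ^ e))).tendsto 0
    simp only [abs_zero, Real.zero_rpow he.ne'] at h2
    exact h2.congr fun y => (abs_oddPow he.ne' y).symm
  · exact (hasDerivAt_oddPow (Or.inl hx)).continuousAt

/-- `hasDerivAt_abs_rpow` with the derivative written as an odd power. -/
lemma hasDerivAt_abs_rpow_oddPow {p : ℝ} (hp : 1 < p) (x : ℝ) :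
    HasDerivAt (fun y : ℝ => |y| ^ p) (p * oddPow (p - 1) x) x := by
  convert hasDerivAt_abs_rpow x hp using 1
  rw [oddPow, ← mul_assoc]; congr 3; ring

/-! ### The generalized sine -/

section GeneralizedSine

open Set Real MeasureTheory

variable {p : ℝ}

/-- The derivative of the `p`-angle with respect to the Euclidean angle `α` along the curve
`|x|^p + |y|^p = 1`, `x = oddPow (2/p) (sin α)`, `y = oddPow (2/p) (cos α)`. For `p > 2` it is
singular where `sin α = 0` (the value there is `0` by convention) and vanishes where `cos α = 0`.
-/
def angleDensity (p α : ℝ) : ℝ := 2 / p * |sin α| ^ (2 / p - 1) * |cos α| ^ (1 - 2 / p)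

/-- The `p`-angle as a function of the Euclidean angle. It is a homeomorphism of `ℝ`, although
neither it nor its inverse is differentiable at all multiples of `π / 2`. -/
def toAngle (p α : ℝ) : ℝ := ∫ x in (0 : ℝ)..α, angleDensity p x

/-- Half the period of the generalized sine; its value is computed in `halfPeriod_eq`. -/
def halfPeriod (p : ℝ) : ℝ := ∫ x in (0 : ℝ)..π, angleDensity p x

lemma angleDensity_nonneg (hp : 2 ≤ p) (α : ℝ) : 0 ≤ angleDensity p α := by
  unfold angleDensity; positivity

lemma angleDensity_neg (p α : ℝ) : angleDensity p (-α) = angleDensity p α := by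
  simp [angleDensity]

lemma angleDensity_periodic (p : ℝ) : Function.Periodic (angleDensity p) π := by
  intro α; simp [angleDensity, sin_add_pi, cos_add_pi]

lemma measurable_angleDensity (p : ℝ) : Measurable (angleDensity p) := by
  unfold angleDensity; fun_prop

lemma continuousAt_angleDensity (hp : 2 ≤ p) {α : ℝ} (hα : sin α ≠ 0) :
    ContinuousAt (angleDensity p) α := by
  have h2 : 0 ≤ 1 - 2 / p := by
    rw [sub_nonneg, div_le_one (by linarith)]; exact hp
  unfold angleDensity
  refine ContinuousAt.mul (ContinuousAt.mul continuousAt_const ?_) ?_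
  · exact (continuous_sin.abs.continuousAt).rpow_const (Or.inl (abs_ne_zero.2 hα))
  · exact (continuous_cos.abs.continuousAt).rpow_const (Or.inr h2)

/-- Near `0` the density is bounded by a multiple of `α ^ (2/p - 1)`, since `sin α ≥ 2 α / π`. -/
lemma intervalIntegrable_angleDensity_zero_pi_div_two (hp : 2 ≤ p) :
    IntervalIntegrable (angleDensity p) volume 0 (π / 2) := by
  have hp0 : 0 < p := by linarith
  have h1 : (-1 : ℝ) < 2 / p - 1 := by
    have : 0 < 2 / p := by positivity
    linarith
  have h2 : 0 ≤ 1 - 2 / p := by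
    rw [sub_nonneg, div_le_one (by linarith)]; exact hp
  have hg : IntervalIntegrable (fun x : ℝ => 2 / p * (2 / π) ^ (2 / p - 1) * x ^ (2 / p - 1))
      volume 0 (π / 2) := (intervalIntegral.intervalIntegrable_rpow' h1).const_mul _
  refine hg.mono_fun (measurable_angleDensity p).aestronglyMeasurable ?_
  rw [uIoc_of_le (by positivity)]
  refine (ae_restrict_iff' measurableSet_Ioc).2 (Eventually.of_forall fun x hx => ?_)
  have hx0 : 0 < x := hx.1
  have hs : 2 / π * x ≤ |sin x| := (mul_le_sin hx0.le hx.2).trans (le_abs_self _)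
  beta_reduce
  rw [norm_of_nonneg (angleDensity_nonneg hp x), norm_of_nonneg (by positivity),
    mul_assoc _ _ (x ^ _),
    ← mul_rpow (by positivity) hx0.le, angleDensity]
  have e1 : |sin x| ^ (2 / p - 1) ≤ (2 / π * x) ^ (2 / p - 1) :=
    rpow_le_rpow_of_nonpos (by positivity) hs (by linarith)
  have e2 : |cos x| ^ (1 - 2 / p) ≤ 1 := rpow_le_one (abs_nonneg _) (abs_cos_le_one x) h2
  calc 2 / p * |sin x| ^ (2 / p - 1) * |cos x| ^ (1 - 2 / p)
      ≤ 2 / p * |sin x| ^ (2 / p - 1) * 1 := by gcongr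
    _ ≤ _ := by rw [mul_one]; gcongr

lemma intervalIntegrable_angleDensity (hp : 2 ≤ p) (a b : ℝ) :
    IntervalIntegrable (angleDensity p) volume a b := by
  have h1 := intervalIntegrable_angleDensity_zero_pi_div_two hp
  have h2 : IntervalIntegrable (angleDensity p) volume (-(π / 2)) 0 := by
    have := ((IntervalIntegrable.iff_comp_neg (by simp)).1 h1).symm
    simpa [angleDensity_neg] using this
  have h3 := h2.trans h1
  refine (angleDensity_periodic p).intervalIntegrable pi_ne_zero (t := -(π / 2)) ?_ a b
  convert h3 using 1
  ring

lemma continuous_toAngle (hp : 2 ≤ p) : Continuous (toAngle p) :=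
  intervalIntegral.continuous_primitive (intervalIntegrable_angleDensity hp) 0

lemma exists_sin_mul_cos_ne_zero {a b : ℝ} (hab : a < b) : ∃ c ∈ Icc a b, sin c * cos c ≠ 0 := by
  by_contra! h
  have hm : (a + b) / 2 ∈ Ioo a b := ⟨by linarith, by linarith⟩
  have hd : HasDerivAt (fun x => sin x * cos x)
      (cos ((a + b) / 2) * cos ((a + b) / 2) + sin ((a + b) / 2) * -sin ((a + b) / 2))
      ((a + b) / 2) := (hasDerivAt_sin _).mul (hasDerivAt_cos _)
  have h0 : HasDerivAt (fun x => sin x * cos x) 0 ((a + b) / 2) :=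
    (hasDerivAt_const _ (0 : ℝ)).congr_of_eventuallyEq <| by
      filter_upwards [Icc_mem_nhds hm.1 hm.2] with x hx using h x hx
  have e1 := hd.unique h0
  have e2 := h _ (Ioo_subset_Icc_self hm)
  have e3 := sin_sq_add_cos_sq ((a + b) / 2)
  rcases mul_eq_zero.1 e2 with e | e <;> rw [e] at e1 e3 <;> nlinarith

/-- The density has zeros, so its positivity is not pointwise; it dominates the continuous function
`(2/p) |sin α cos α|`, whose zeros are isolated. -/
lemma strictMono_toAngle (hp : 2 ≤ p) : StrictMono (toAngle p) := by
  intro a b hab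
  have hp0 : 0 < p := by linarith
  rw [← sub_pos, toAngle, toAngle, intervalIntegral.integral_interval_sub_left
    (intervalIntegrable_angleDensity hp _ _) (intervalIntegrable_angleDensity hp _ _)]
  have hcont : Continuous fun x : ℝ => 2 / p * |sin x * cos x| := by fun_prop
  have hpos : 0 < ∫ x in a..b, 2 / p * |sin x * cos x| := by
    refine intervalIntegral.integral_pos hab hcont.continuousOn (fun x _ => by positivity) ?_
    obtain ⟨c, hc, h⟩ := exists_sin_mul_cos_ne_zero hab
    exact ⟨c, hc, by positivity⟩
  refine hpos.trans_le (intervalIntegral.integral_mono_on hab.le (hcont.intervalIntegrable _ _)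
    (intervalIntegrable_angleDensity hp _ _) fun x _ => ?_)
  rcases eq_or_ne (sin x) 0 with h | h
  · simpa [h] using angleDensity_nonneg hp x
  rcases eq_or_ne (cos x) 0 with h' | h'
  · simpa [h'] using angleDensity_nonneg hp x
  rw [angleDensity, abs_mul, ← mul_assoc]
  have hp2 : 0 < 2 / p := by positivity
  have hp2' : 2 / p ≤ 1 := by rw [div_le_one hp0]; exact hp
  have e1 : |sin x| ≤ |sin x| ^ (2 / p - 1) := by
    conv_lhs => rw [← rpow_one |sin x|]
    exact rpow_le_rpow_of_exponent_ge (abs_pos.2 h) (abs_sin_le_one x) (by linarith)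
  have e2 : |cos x| ≤ |cos x| ^ (1 - 2 / p) := by
    conv_lhs => rw [← rpow_one |cos x|]
    exact rpow_le_rpow_of_exponent_ge (abs_pos.2 h') (abs_cos_le_one x) (by linarith)
  gcongr

@[simp] lemma toAngle_zero (p : ℝ) : toAngle p 0 = 0 := by simp [toAngle]

lemma halfPeriod_pos (hp : 2 ≤ p) : 0 < halfPeriod p := by
  have := strictMono_toAngle hp pi_pos
  rwa [toAngle_zero] at this

lemma toAngle_int_mul_pi (hp : 2 ≤ p) (k : ℤ) : toAngle p (k * π) = k * halfPeriod p := by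
  have := (angleDensity_periodic p).intervalIntegral_add_zsmul_eq k 0
    (intervalIntegrable_angleDensity hp)
  simpa [toAngle, halfPeriod] using this

lemma surjective_toAngle (hp : 2 ≤ p) : Function.Surjective (toAngle p) :=
  (continuous_toAngle hp).surjective
    ((angleDensity_periodic p).tendsto_atTop_intervalIntegral_of_pos (halfPeriod_pos hp) pi_pos)
    ((angleDensity_periodic p).tendsto_atBot_intervalIntegral_of_pos (halfPeriod_pos hp) pi_pos)

lemma hasDerivAt_toAngle (hp : 2 ≤ p) {α : ℝ} (hα : sin α ≠ 0) :
    HasDerivAt (toAngle p) (angleDensity p α) α :=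
  intervalIntegral.integral_hasDerivAt_right (intervalIntegrable_angleDensity hp _ _)
    (measurable_angleDensity p).stronglyMeasurable.stronglyMeasurableAtFilter
    (continuousAt_angleDensity hp hα)

/-- The Euclidean angle as a function of the `p`-angle: the inverse of `toAngle`. -/
def ofAngle (p : ℝ) : ℝ → ℝ := Function.invFun (toAngle p)

lemma toAngle_ofAngle (hp : 2 ≤ p) (θ : ℝ) : toAngle p (ofAngle p θ) = θ :=
  Function.rightInverse_invFun (surjective_toAngle hp) θ

lemma ofAngle_toAngle (hp : 2 ≤ p) (α : ℝ) : ofAngle p (toAngle p α) = α :=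
  Function.leftInverse_invFun (strictMono_toAngle hp).injective α

lemma continuous_ofAngle (hp : 2 ≤ p) : Continuous (ofAngle p) := by
  have h : ofAngle p =
      ((strictMono_toAngle hp).orderIsoOfSurjective _ (surjective_toAngle hp)).symm := by
    funext θ
    apply (strictMono_toAngle hp).injective
    rw [toAngle_ofAngle hp]
    exact (((strictMono_toAngle hp).orderIsoOfSurjective _
      (surjective_toAngle hp)).apply_symm_apply θ).symm
  rw [h]
  exact OrderIso.continuous _

/-- The generalized sine: the solution of `(|S'|^(p-2) S')' + (p-1) |S|^(p-2) S = 0` with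
`S 0 = 0` and `S' 0 = 1`. It satisfies `|S|^p + |S'|^p = 1`. -/
def pSin (p θ : ℝ) : ℝ := oddPow (2 / p) (sin (ofAngle p θ))

/-- The generalized cosine, the derivative of `pSin`. -/
def pCos (p θ : ℝ) : ℝ := oddPow (2 / p) (cos (ofAngle p θ))

/-- The flux `|C|^(p-2) C` of the generalized cosine `C`. Unlike `C` itself it is differentiable
everywhere. -/
def pCosPow (p θ : ℝ) : ℝ := oddPow (p - 1) (pCos p θ)

lemma abs_pSin_rpow (hp : 2 ≤ p) (θ : ℝ) : |pSin p θ| ^ p = sin (ofAngle p θ) ^ 2 := by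
  have hp0 : p ≠ 0 := by linarith
  rw [pSin, abs_oddPow (by positivity), ← rpow_mul (abs_nonneg _), div_mul_cancel₀ _ hp0]
  norm_num

lemma abs_pCos_rpow (hp : 2 ≤ p) (θ : ℝ) : |pCos p θ| ^ p = cos (ofAngle p θ) ^ 2 := by
  have hp0 : p ≠ 0 := by linarith
  rw [pCos, abs_oddPow (by positivity), ← rpow_mul (abs_nonneg _), div_mul_cancel₀ _ hp0]
  norm_num

lemma abs_pSin_rpow_add_abs_pCos_rpow (hp : 2 ≤ p) (θ : ℝ) :
    |pSin p θ| ^ p + |pCos p θ| ^ p = 1 := by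
  rw [abs_pSin_rpow hp, abs_pCos_rpow hp, sin_sq_add_cos_sq]

lemma pCosPow_eq (p θ : ℝ) : pCosPow p θ = oddPow (2 / p * (p - 1)) (cos (ofAngle p θ)) := by
  rw [pCosPow, pCos, oddPow_oddPow]

lemma continuous_pSin (hp : 2 ≤ p) : Continuous (pSin p) :=
  (continuous_oddPow (by positivity)).comp (continuous_sin.comp (continuous_ofAngle hp))

lemma continuous_pCos (hp : 2 ≤ p) : Continuous (pCos p) :=
  (continuous_oddPow (by positivity)).comp (continuous_cos.comp (continuous_ofAngle hp))

lemma continuous_pCosPow (hp : 2 ≤ p) : Continuous (pCosPow p) :=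
  (continuous_oddPow (by linarith)).comp (continuous_pCos hp)

lemma pSin_eq_zero_iff (hp : 2 ≤ p) {θ : ℝ} :
    pSin p θ = 0 ↔ ∃ k : ℤ, (k : ℝ) * halfPeriod p = θ := by
  rw [pSin, oddPow_eq_zero, sin_eq_zero_iff]
  constructor
  · rintro ⟨k, hk⟩
    exact ⟨k, by rw [← toAngle_int_mul_pi hp, hk, toAngle_ofAngle hp]⟩
  · rintro ⟨k, rfl⟩
    exact ⟨k, by rw [← toAngle_int_mul_pi hp, ofAngle_toAngle hp]⟩

lemma hasDerivAt_ofAngle (hp : 2 ≤ p) {θ : ℝ} (hs : sin (ofAngle p θ) ≠ 0)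
    (hc : cos (ofAngle p θ) ≠ 0) : HasDerivAt (ofAngle p) (angleDensity p (ofAngle p θ))⁻¹ θ := by
  refine HasDerivAt.of_local_left_inverse (continuous_ofAngle hp).continuousAt
    (hasDerivAt_toAngle hp hs) ?_ (Eventually.of_forall fun y => toAngle_ofAngle hp y)
  unfold angleDensity
  positivity

lemma hasDerivAt_pSin_aux (hp : 2 ≤ p) {θ : ℝ} (hs : sin (ofAngle p θ) ≠ 0)
    (hc : cos (ofAngle p θ) ≠ 0) : HasDerivAt (pSin p) (pCos p θ) θ := by
  have h := (hasDerivAt_oddPow (e := 2 / p) (Or.inl hs)).comp θ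
    ((hasDerivAt_sin _).comp θ (hasDerivAt_ofAngle hp hs hc))
  refine h.congr_deriv ?_
  have h1 : 0 < |sin (ofAngle p θ)| := abs_pos.2 hs
  have h2 : 0 < |cos (ofAngle p θ)| := abs_pos.2 hc
  have hp0 : p ≠ 0 := by linarith
  rw [pCos, oddPow, angleDensity, show 2 / p - 1 = -(1 - 2 / p) by ring,
    rpow_neg h1.le, rpow_neg h2.le]
  have := rpow_pos_of_pos h1 (1 - 2 / p)
  have := rpow_pos_of_pos h2 (1 - 2 / p)
  field_simp

lemma hasDerivAt_pCosPow_aux (hp : 2 ≤ p) {θ : ℝ} (hs : sin (ofAngle p θ) ≠ 0)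
    (hc : cos (ofAngle p θ) ≠ 0) :
    HasDerivAt (pCosPow p) (-((p - 1) * oddPow (p - 1) (pSin p θ))) θ := by
  have hp0 : p ≠ 0 := by linarith
  have h := (hasDerivAt_oddPow (e := 2 / p * (p - 1)) (Or.inl hc)).comp θ
    ((hasDerivAt_cos _).comp θ (hasDerivAt_ofAngle hp hs hc))
  have he : (pCosPow p) = oddPow (2 / p * (p - 1)) ∘ cos ∘ ofAngle p := by
    funext x; exact pCosPow_eq p x
  rw [he]
  refine h.congr_deriv ?_
  have h1 : 0 < |sin (ofAngle p θ)| := abs_pos.2 hs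
  have h2 : 0 < |cos (ofAngle p θ)| := abs_pos.2 hc
  have e1 : 2 / p * (p - 1) - 1 = 1 - 2 / p := by field_simp; ring
  rw [pSin, oddPow_oddPow, oddPow, angleDensity, e1, show 2 / p - 1 = -(1 - 2 / p) by ring,
    rpow_neg h1.le]
  have := rpow_pos_of_pos h1 (1 - 2 / p)
  have := rpow_pos_of_pos h2 (1 - 2 / p)
  field_simp

/-- The points where the change from the `p`-angle to the Euclidean angle fails to be differentiable
are isolated. -/
lemma eventually_sin_ne_zero_and_cos_ne_zero (hp : 2 ≤ p) (θ : ℝ) :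
    ∀ᶠ x in 𝓝[≠] θ, sin (ofAngle p x) ≠ 0 ∧ cos (ofAngle p x) ≠ 0 := by
  have hα : ∀ α : ℝ, ∀ᶠ x in 𝓝[≠] α, sin x ≠ 0 ∧ cos x ≠ 0 := by
    intro α
    have h1 : ∀ᶠ x in 𝓝[≠] α, sin x ≠ 0 := by
      by_cases h : sin α = 0
      · refine (hasDerivAt_sin α).eventually_ne ?_ 
        intro h'; have := sin_sq_add_cos_sq α; rw [h, h'] at this; norm_num at this
      · exact (continuous_sin.continuousAt.eventually_ne h).filter_mono nhdsWithin_le_nhds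
    have h2 : ∀ᶠ x in 𝓝[≠] α, cos x ≠ 0 := by
      by_cases h : cos α = 0
      · refine (hasDerivAt_cos α).eventually_ne ?_ 
        intro h'; have := sin_sq_add_cos_sq α; rw [h, neg_eq_zero.1 h'] at this; norm_num at this
      · exact (continuous_cos.continuousAt.eventually_ne h).filter_mono nhdsWithin_le_nhds
    exact h1.and h2
  have ht : Tendsto (ofAngle p) (𝓝[≠] θ) (𝓝[≠] (ofAngle p θ)) := by
    refine tendsto_nhdsWithin_of_tendsto_nhds_of_eventually_within _
      ((continuous_ofAngle hp).continuousAt.tendsto.mono_left nhdsWithin_le_nhds) ?_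
    filter_upwards [self_mem_nhdsWithin] with x hx h
    refine hx ?_
    rw [mem_singleton_iff, ← toAngle_ofAngle hp x, h, toAngle_ofAngle hp]
  exact ht.eventually (hα _)

/-- A version of `hasDerivAt_of_hasDerivAt_of_ne` that needs the derivative only near the point. -/
lemma hasDerivAt_of_eventually_hasDerivAt {f g : ℝ → ℝ} {x : ℝ} (hf : Continuous f)
    (hg : Continuous g) (h : ∀ᶠ y in 𝓝[≠] x, HasDerivAt f (g y) y) : HasDerivAt f (g x) x := by
  have hd : DifferentiableOn ℝ f {y | HasDerivAt f (g y) y} := fun y hy =>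
    (HasDerivAt.differentiableAt hy).differentiableWithinAt
  have hlim : Tendsto (deriv f) (𝓝[≠] x) (𝓝 (g x)) :=
    (hg.continuousAt.tendsto.mono_left nhdsWithin_le_nhds).congr' <| by
      filter_upwards [h] with y hy using hy.deriv.symm
  have hR := hasDerivWithinAt_Ici_of_tendsto_deriv hd hf.continuousAt.continuousWithinAt
    (nhdsWithin_mono x (fun y hy => ne_of_gt hy) h)
    (hlim.mono_left (nhdsWithin_mono x fun y hy => ne_of_gt hy))
  have hL := hasDerivWithinAt_Iic_of_tendsto_deriv hd hf.continuousAt.continuousWithinAt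
    (nhdsWithin_mono x (fun y hy => ne_of_lt hy) h)
    (hlim.mono_left (nhdsWithin_mono x fun y hy => ne_of_lt hy))
  simpa using hL.union hR

lemma hasDerivAt_pSin (hp : 2 ≤ p) (θ : ℝ) : HasDerivAt (pSin p) (pCos p θ) θ :=
  hasDerivAt_of_eventually_hasDerivAt (continuous_pSin hp) (continuous_pCos hp) <|
    (eventually_sin_ne_zero_and_cos_ne_zero hp θ).mono fun _ h => hasDerivAt_pSin_aux hp h.1 h.2

lemma hasDerivAt_pCosPow (hp : 2 ≤ p) (θ : ℝ) :
    HasDerivAt (pCosPow p) (-((p - 1) * oddPow (p - 1) (pSin p θ))) θ :=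
  hasDerivAt_of_eventually_hasDerivAt (continuous_pCosPow hp)
    (g := fun θ => -((p - 1) * oddPow (p - 1) (pSin p θ)))
    (((continuous_oddPow (by linarith)).comp (continuous_pSin hp)).const_mul _).neg <|
    (eventually_sin_ne_zero_and_cos_ne_zero hp θ).mono fun _ h => hasDerivAt_pCosPow_aux hp h.1 h.2

/-! ### The half period -/

/-- The real Beta integral and its convergence. -/
lemma integral_rpow_mul_one_sub_rpow {a b : ℝ} (ha : 0 < a) (hb : 0 < b) :
    IntervalIntegrable (fun x : ℝ => x ^ (a - 1) * (1 - x) ^ (b - 1)) volume 0 1 ∧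
      ∫ x in (0 : ℝ)..1, x ^ (a - 1) * (1 - x) ^ (b - 1) = Gamma a * Gamma b / Gamma (a + b) := by
  have hc := Complex.betaIntegral_convergent (u := a) (v := b) (by simpa) (by simpa)
  have heq : EqOn (fun x : ℝ => ((x : ℂ) ^ ((a : ℂ) - 1) * (1 - (x : ℂ)) ^ ((b : ℂ) - 1)).re)
      (fun x : ℝ => x ^ (a - 1) * (1 - x) ^ (b - 1)) (Ioc 0 1) := by
    intro x hx
    have h2 : 0 ≤ 1 - x := by linarith [hx.2]
    have e1 : ((x : ℂ) ^ ((a : ℂ) - 1)) = ((x ^ (a - 1) : ℝ) : ℂ) := by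
      rw [Complex.ofReal_cpow hx.1.le]; norm_cast
    have e2 : ((1 - (x : ℂ)) ^ ((b : ℂ) - 1)) = (((1 - x) ^ (b - 1) : ℝ) : ℂ) := by
      rw [Complex.ofReal_cpow h2]; norm_cast
    simp only [e1, e2]
    rw [← Complex.ofReal_mul, Complex.ofReal_re]
  rw [intervalIntegrable_iff_integrableOn_Ioc_of_le zero_le_one] at hc ⊢
  have hre := hc.re
  refine ⟨(integrableOn_congr_fun heq measurableSet_Ioc).1 hre, ?_⟩
  have hb' := ProbabilityTheory.beta_eq_betaIntegralReal a b ha hb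
  rw [ProbabilityTheory.beta, Complex.betaIntegral,
    intervalIntegral.integral_of_le zero_le_one] at hb'
  rw [hb', intervalIntegral.integral_of_le zero_le_one, ← RCLike.re_to_complex, ← integral_re hc]
  exact (setIntegral_congr_fun measurableSet_Ioc heq).symm

/-- The substitution `x = sin² α` turns the integral into the Beta integral `B (1/p, 1 - 1/p) / p`,
which the reflection formula of the Gamma function evaluates. -/
lemma integral_angleDensity_zero_pi_div_two (hp : 2 ≤ p) :
    ∫ x in (0 : ℝ)..π / 2, angleDensity p x = 1 / p * (π / sin (π / p)) := by
  have hp0 : 0 < p := by linarith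
  have ha : 0 < 1 / p := by positivity
  have hb : 0 < 1 - 1 / p := by
    rw [sub_pos, div_lt_one hp0]; linarith
  obtain ⟨hint, hval⟩ := integral_rpow_mul_one_sub_rpow ha hb
  have hpi : (0 : ℝ) ≤ π / 2 := by positivity
  set g : ℝ → ℝ := fun x => 1 / p * (x ^ (1 / p - 1) * (1 - x) ^ (1 - 1 / p - 1)) with hg
  have hkey : EqOn (angleDensity p) (fun x => (g ∘ fun x => sin x ^ 2) x * (2 * sin x * cos x))
      (Ioo 0 (π / 2)) := by
    intro x hx
    have hs : 0 < sin x := sin_pos_of_pos_of_lt_pi hx.1 (by linarith [hx.2])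
    have hcx : 0 < cos x := cos_pos_of_mem_Ioo ⟨by linarith [hx.1], hx.2⟩
    have h1 : 1 - sin x ^ 2 = cos x ^ 2 := by linarith [sin_sq_add_cos_sq x]
    simp only [hg, Function.comp]
    rw [h1, angleDensity, abs_of_pos hs, abs_of_pos hcx, ← rpow_natCast, ← rpow_natCast,
      ← rpow_mul hs.le, ← rpow_mul hcx.le]
    have e1 : ((2 : ℕ) : ℝ) * (1 / p - 1) = 2 / p - 1 - 1 := by push_cast; ring
    have e2 : ((2 : ℕ) : ℝ) * (1 - 1 / p - 1) = 1 - 2 / p - 1 := by push_cast; ring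
    rw [e1, e2, rpow_sub_one hs.ne' (2 / p - 1), rpow_sub_one hcx.ne']
    field_simp
  have hmaps : (fun x => sin x ^ 2) '' Ioo 0 (π / 2) ⊆ Ioo 0 1 := by
    rintro _ ⟨x, hx, rfl⟩
    have hs : 0 < sin x := sin_pos_of_pos_of_lt_pi hx.1 (by linarith [hx.2])
    have hcx : 0 < cos x := cos_pos_of_mem_Ioo ⟨by linarith [hx.1], hx.2⟩
    refine ⟨by positivity, ?_⟩
    have := sin_sq_add_cos_sq x
    show sin x ^ 2 < 1
    nlinarith
  have hmaps' : (fun x => sin x ^ 2) '' uIcc 0 (π / 2) ⊆ Icc 0 1 := by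
    rintro _ ⟨x, hx, rfl⟩
    exact ⟨sq_nonneg _, sin_sq_le_one x⟩
  have hsub := intervalIntegral.integral_comp_mul_deriv''' (a := 0) (b := π / 2)
    (f := fun x => sin x ^ 2) (f' := fun x => 2 * sin x * cos x) (g := g)
    (by fun_prop)
    (fun x _ => by
      have := (hasDerivAt_sin x).pow 2
      refine (this.congr_deriv ?_).hasDerivWithinAt
      simp)
    (by
      rw [min_eq_left hpi, max_eq_right hpi]
      intro x hx
      have hx' := hmaps hx
      refine (ContinuousAt.mul continuousAt_const (ContinuousAt.mul ?_ ?_)).continuousWithinAt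
      · exact continuousAt_id.rpow_const (Or.inl hx'.1.ne')
      · exact (continuousAt_const.sub continuousAt_id).rpow_const (Or.inl (sub_pos.2 hx'.2).ne'))
    (by
      refine IntegrableOn.mono_set ?_ hmaps'
      rw [integrableOn_Icc_iff_integrableOn_Ioc,
        ← intervalIntegrable_iff_integrableOn_Ioc_of_le zero_le_one]
      exact hint.const_mul _)
    (by
      rw [uIcc_of_le hpi, integrableOn_Icc_iff_integrableOn_Ioo]
      refine (integrableOn_congr_fun hkey measurableSet_Ioo).1 ?_
      rw [← integrableOn_Ioc_iff_integrableOn_Ioo,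
        ← intervalIntegrable_iff_integrableOn_Ioc_of_le hpi]
      exact intervalIntegrable_angleDensity hp _ _)
  have h1 : ∫ x in (0 : ℝ)..π / 2, angleDensity p x =
      ∫ x in (0 : ℝ)..π / 2, (g ∘ fun x => sin x ^ 2) x * (2 * sin x * cos x) := by
    rw [intervalIntegral.integral_of_le hpi, intervalIntegral.integral_of_le hpi,
      integral_Ioc_eq_integral_Ioo, integral_Ioc_eq_integral_Ioo]
    exact setIntegral_congr_fun measurableSet_Ioo hkey
  rw [h1, hsub]
  simp only [sin_zero, sin_pi_div_two, hg]
  norm_num only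
  rw [intervalIntegral.integral_const_mul, hval, add_sub_cancel, Gamma_one, div_one,
    Gamma_mul_Gamma_one_sub]
  congr 3; ring_nf

lemma halfPeriod_eq (hp : 2 ≤ p) : halfPeriod p = 2 * π / (p * sin (π / p)) := by
  have h0 : ∫ x in (π / 2)..π, angleDensity p x = ∫ x in (0 : ℝ)..π / 2, angleDensity p x := by
    have := intervalIntegral.integral_comp_sub_left (a := 0) (b := π / 2) (angleDensity p) π
    rw [sub_zero, show π - π / 2 = π / 2 by ring] at this
    rw [← this]
    refine intervalIntegral.integral_congr fun x _ => ?_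
    show angleDensity p (π - x) = _
    rw [← angleDensity_neg, neg_sub, (angleDensity_periodic p).sub_eq]
  rw [halfPeriod, ← intervalIntegral.integral_add_adjacent_intervals
    (intervalIntegrable_angleDensity hp 0 (π / 2)) (intervalIntegrable_angleDensity hp (π / 2) π),
    h0, integral_angleDensity_zero_pi_div_two hp]
  have hp0 : p ≠ 0 := by linarith
  field_simp
  ring

lemma piP_eq (hp : 2 ≤ p) : piP p = (p - 1) ^ (1 / p) * halfPeriod p := by
  rw [halfPeriod_eq hp, piP]; ring

end GeneralizedSine

open Set
open scoped NNReal

/-! ### The equation of the Prüfer angle -/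

section Angle

/-- `θ` is the Prüfer angle on `[0, 1]` with initial value `0`: it solves
`θ' = μ (1 + (q - 1) f(θ))`. In the application `f = |pSin p ·|^p`, so that the bracket is
`|C(θ)|^p + q |S(θ)|^p`. -/
structure IsAngle (f q : ℝ → ℝ) (μ : ℝ) (θ : ℝ → ℝ) : Prop where
  zero : θ 0 = 0
  hasDerivWithinAt : ∀ t ∈ Icc (0 : ℝ) 1,
    HasDerivWithinAt θ (μ * (1 + (q t - 1) * f (θ t))) (Icc 0 1) t

/-- The standing assumptions on the angle equation: `f` is Lipschitz with values in `[0, 1]`, and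
`q` is continuous with `m ≤ q ≤ M`. The bounds are normalized by `m ≤ 1 ≤ M`, so that the angular
speed `1 + (q - 1) f`, a convex combination of `1` and `q`, also lies between `m` and `M`. -/
structure AngleData (f q : ℝ → ℝ) (L : ℝ≥0) (m M : ℝ) : Prop where
  lipschitz : LipschitzWith L f
  nonneg : ∀ x, 0 ≤ f x
  le_one : ∀ x, f x ≤ 1
  continuousOn : ContinuousOn q (Icc 0 1)
  pos : 0 < m
  le_weight : ∀ t ∈ Icc (0 : ℝ) 1, m ≤ q t
  weight_le : ∀ t ∈ Icc (0 : ℝ) 1, q t ≤ M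
  lower_le_one : m ≤ 1
  one_le_upper : 1 ≤ M

variable {f q θ θ' : ℝ → ℝ} {L : ℝ≥0} {m M μ ν : ℝ}

lemma IsAngle.continuousOn (h : IsAngle f q μ θ) : ContinuousOn θ (Icc 0 1) :=
  fun t ht => (h.hasDerivWithinAt t ht).continuousWithinAt

lemma IsAngle.hasDerivWithinAt_Ici (h : IsAngle f q μ θ) :
    ∀ t ∈ Ico (0 : ℝ) 1, HasDerivWithinAt θ (μ * (1 + (q t - 1) * f (θ t))) (Ici t) t :=
  fun t ht => (h.hasDerivWithinAt t (Ico_subset_Icc_self ht)).mono_of_mem_nhdsWithin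
    (Icc_mem_nhdsGE_of_mem ht)

namespace AngleData

lemma le_speed (h : AngleData f q L m M) {t : ℝ} (ht : t ∈ Icc (0 : ℝ) 1) (x : ℝ) :
    m ≤ 1 + (q t - 1) * f x := by
  nlinarith [h.nonneg x, h.le_one x, h.le_weight t ht, h.lower_le_one]

lemma speed_le (h : AngleData f q L m M) {t : ℝ} (ht : t ∈ Icc (0 : ℝ) 1) (x : ℝ) :
    1 + (q t - 1) * f x ≤ M := by
  nlinarith [h.nonneg x, h.le_one x, h.weight_le t ht, h.one_le_upper]

lemma upper_pos (h : AngleData f q L m M) : 0 < M := by linarith [h.one_le_upper]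

lemma lipschitzWith_field (h : AngleData f q L m M) (hμ : 0 ≤ μ) {t : ℝ}
    (ht : t ∈ Icc (0 : ℝ) 1) :
    LipschitzWith (μ.toNNReal * M.toNNReal * L) fun x => μ * (1 + (q t - 1) * f x) := by
  refine LipschitzWith.of_dist_le_mul fun x y => ?_
  have h1 := h.lipschitz.dist_le_mul x y
  have h2 : |q t - 1| ≤ M := by
    rw [abs_le]
    constructor <;> linarith [h.le_weight t ht, h.weight_le t ht, h.pos, h.one_le_upper]
  rw [Real.dist_eq] at h1 ⊢
  have h3 : μ * (1 + (q t - 1) * f x) - μ * (1 + (q t - 1) * f y) =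
      μ * ((q t - 1) * (f x - f y)) := by ring
  rw [h3, abs_mul, abs_mul, abs_of_nonneg hμ]
  push_cast
  rw [Real.coe_toNNReal _ hμ, Real.coe_toNNReal _ h.upper_pos.le, mul_assoc, mul_assoc]
  have := h.upper_pos
  gcongr

lemma exists_isAngle (h : AngleData f q L m M) (hμ : 0 ≤ μ) : ∃ θ, IsAngle f q μ θ := by
  have hP : IsPicardLindelof (fun t x => μ * (1 + (q t - 1) * f x))
      (tmin := 0) (tmax := 1) ⟨0, by simp⟩ (0 : ℝ) (μ.toNNReal * M.toNNReal) 0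
      (μ.toNNReal * M.toNNReal) (μ.toNNReal * M.toNNReal * L) :=
    { lipschitzOnWith := fun t ht => (h.lipschitzWith_field hμ ht).lipschitzOnWith
      continuousOn := fun x _ => continuousOn_const.mul <| continuousOn_const.add <|
        (h.continuousOn.sub continuousOn_const).mul continuousOn_const
      norm_le := fun t ht x _ => by
        push_cast
        rw [Real.coe_toNNReal _ hμ, Real.coe_toNNReal _ h.upper_pos.le, Real.norm_of_nonneg
          (mul_nonneg hμ (h.pos.le.trans (h.le_speed ht x)))]
        exact mul_le_mul_of_nonneg_left (h.speed_le ht x) hμ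
      mul_max_le := by simp }
  obtain ⟨θ, h0, hd⟩ := hP.exists_eq_forall_mem_Icc_hasDerivWithinAt₀
  exact ⟨θ, h0, hd⟩

lemma eq_of_isAngle (h : AngleData f q L m M) (hμ : 0 ≤ μ) (h1 : IsAngle f q μ θ)
    (h2 : IsAngle f q μ θ') : EqOn θ θ' (Icc 0 1) :=
  ODE_solution_unique_of_mem_Icc_right (s := fun _ => univ)
    (v := fun t x => μ * (1 + (q t - 1) * f x)) (K := μ.toNNReal * M.toNNReal * L)
    (fun _ ht => (h.lipschitzWith_field hμ (Ico_subset_Icc_self ht)).lipschitzOnWith)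
    h1.continuousOn h1.hasDerivWithinAt_Ici (fun _ _ => mem_univ _)
    h2.continuousOn h2.hasDerivWithinAt_Ici (fun _ _ => mem_univ _) (h1.zero.trans h2.zero.symm)

lemma le_angle_one (h : AngleData f q L m M) (hμ : 0 ≤ μ) (h1 : IsAngle f q μ θ) :
    μ * m ≤ θ 1 := by
  have := image_le_of_deriv_right_le_deriv_boundary (a := 0) (b := 1)
    (f := fun t => μ * m * t) (f' := fun _ => μ * m) (B := θ)
    (by fun_prop) (fun t _ => by simpa using ((hasDerivAt_id t).const_mul (μ * m)).hasDerivWithinAt)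
    (by simp [h1.zero]) h1.continuousOn h1.hasDerivWithinAt_Ici
    (fun t ht => mul_le_mul_of_nonneg_left (h.le_speed (Ico_subset_Icc_self ht) _) hμ)
    (right_mem_Icc.2 zero_le_one)
  simpa using this

lemma angle_one_le (h : AngleData f q L m M) (hμ : 0 ≤ μ) (h1 : IsAngle f q μ θ) :
    θ 1 ≤ μ * M := by
  have := image_le_of_deriv_right_le_deriv_boundary (a := 0) (b := 1)
    (B := fun t => μ * M * t) (B' := fun _ => μ * M) (f := θ)
    h1.continuousOn h1.hasDerivWithinAt_Ici (by simp [h1.zero])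
    (by fun_prop) (fun t _ => by simpa using ((hasDerivAt_id t).const_mul (μ * M)).hasDerivWithinAt)
    (fun t ht => mul_le_mul_of_nonneg_left (h.speed_le (Ico_subset_Icc_self ht) _) hμ)
    (right_mem_Icc.2 zero_le_one)
  simpa using this

/-- The terminal angle is strictly increasing in `μ`. Comparing `θ + ε t` instead of `θ` with the
other solution gives the strict inequality at `t = 1`. -/
lemma angle_one_lt (h : AngleData f q L m M) (hμ : 0 ≤ μ) (hμν : μ < ν)
    (h1 : IsAngle f q μ θ) (h2 : IsAngle f q ν θ') : θ 1 < θ' 1 := by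
  set K : ℝ≥0 := μ.toNNReal * M.toNNReal * L with hK
  obtain ⟨ε, hε, hεK⟩ : ∃ ε > 0, ε * (1 + K) < (ν - μ) * m := by
    have hpos : 0 < (ν - μ) * m := mul_pos (sub_pos.2 hμν) h.pos
    have hK1 : (0 : ℝ) < 1 + K := by positivity
    refine ⟨(ν - μ) * m / (2 * (1 + K)), by positivity, ?_⟩
    field_simp
    linarith
  have := image_le_of_deriv_right_lt_deriv_boundary' (a := 0) (b := 1)
    (f := fun t => θ t + ε * t) (f' := fun t => μ * (1 + (q t - 1) * f (θ t)) + ε) (B := θ')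
    (h1.continuousOn.add (by fun_prop))
    (fun t ht => (h1.hasDerivWithinAt_Ici t ht).add
      (by simpa using ((hasDerivAt_id t).const_mul ε).hasDerivWithinAt))
    (by simp [h1.zero, h2.zero]) h2.continuousOn h2.hasDerivWithinAt_Ici
    (fun t ht heq => by
      have ht' := Ico_subset_Icc_self ht
      have e1 := (h.lipschitzWith_field hμ ht').dist_le_mul (θ t) (θ' t)
      rw [← heq, Real.dist_eq, Real.dist_eq, ← hK] at e1
      have e2 : |θ t - (θ t + ε * t)| ≤ ε := by
        rw [sub_add_cancel_left, abs_neg, abs_of_nonneg (mul_nonneg hε.le ht.1)]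
        nlinarith [ht.2]
      have e3 : (K : ℝ) * |θ t - (θ t + ε * t)| ≤ K * ε := by gcongr
      have e4 := (abs_le.1 (e1.trans e3)).2
      rw [← heq]
      have e5 := h.le_speed ht' (θ t + ε * t)
      have e6 := mul_le_mul_of_nonneg_left e5 (sub_pos.2 hμν).le
      linarith)
    (right_mem_Icc.2 zero_le_one)
  simp only [mul_one] at this
  linarith

/-- Grönwall's inequality: the terminal angle is continuous in `μ`. -/
lemma dist_angle_one_le (h : AngleData f q L m M) (hμ : 0 ≤ μ)
    (h1 : IsAngle f q μ θ) (h2 : IsAngle f q ν θ') :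
    dist (θ 1) (θ' 1) ≤
      gronwallBound 0 (μ.toNNReal * M.toNNReal * L : ℝ≥0) (|ν - μ| * M) 1 := by
  have := dist_le_of_approx_trajectories_ODE_of_mem (a := 0) (b := 1) (δ := 0) (εf := 0)
    (εg := |ν - μ| * M) (s := fun _ => univ)
    (v := fun t x => μ * (1 + (q t - 1) * f x)) (K := μ.toNNReal * M.toNNReal * L)
    (fun _ ht => (h.lipschitzWith_field hμ (Ico_subset_Icc_self ht)).lipschitzOnWith)
    h1.continuousOn h1.hasDerivWithinAt_Ici (fun t _ => by simp) (fun _ _ => mem_univ _)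
    h2.continuousOn h2.hasDerivWithinAt_Ici (fun t ht => by
      have ht' := Ico_subset_Icc_self ht
      rw [Real.dist_eq, ← sub_mul, abs_mul, abs_of_nonneg (h.pos.le.trans (h.le_speed ht' _))]
      exact mul_le_mul_of_nonneg_left (h.speed_le ht' _) (abs_nonneg _))
    (fun _ _ => mem_univ _) (by simp [h1.zero, h2.zero]) 1 (right_mem_Icc.2 zero_le_one)
  simpa using this

/-- The terminal angle is an increasing bijection of `(0, ∞)` as a function of `μ`; here `E` is its
inverse. The bounds for `E` are what makes the eigenvalues stable when `q` is close to `1`. -/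
theorem exists_parameter (h : AngleData f q L m M) :
    ∃ E : ℝ → ℝ, (∀ c > 0, 0 < E c ∧ c / M ≤ E c ∧ E c ≤ c / m) ∧
      StrictMonoOn E (Ioi 0) ∧
      ∀ μ > 0, ∀ c > 0, ∀ θ, IsAngle f q μ θ → (θ 1 = c ↔ μ = E c) := by
  choose! Θ hΘ using fun μ (hμ : 0 ≤ μ) => h.exists_isAngle hμ
  set D : ℝ → ℝ := fun μ => Θ μ 1 with hD
  have hmono : StrictMonoOn D (Ici 0) := fun μ hμ ν hν hlt =>
    h.angle_one_lt hμ hlt (hΘ μ hμ) (hΘ ν hν)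
  have hcont : ContinuousOn D (Ici 0) := by
    intro μ hμ
    rw [ContinuousWithinAt, tendsto_iff_dist_tendsto_zero]
    have hg : Tendsto (fun ν => gronwallBound 0 (μ.toNNReal * M.toNNReal * L : ℝ≥0)
        (|ν - μ| * M) 1) (𝓝[Ici 0] μ) (𝓝 0) := by
      have hc : Continuous fun ν => gronwallBound 0 (μ.toNNReal * M.toNNReal * L : ℝ≥0)
        (|ν - μ| * M) 1 := (gronwallBound_continuous_ε _ _ _).comp (by fun_prop)
      have := (hc.tendsto μ).mono_left (nhdsWithin_le_nhds (s := Ici 0))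
      simpa [gronwallBound_ε0_δ0] using this
    refine squeeze_zero' (Eventually.of_forall fun _ => dist_nonneg) ?_ hg
    filter_upwards [self_mem_nhdsWithin] with ν hν
    rw [dist_comm]
    exact h.dist_angle_one_le hμ (hΘ μ hμ) (hΘ ν hν)
  have hlow : ∀ μ, 0 ≤ μ → μ * m ≤ D μ := fun μ hμ => h.le_angle_one hμ (hΘ μ hμ)
  have hupp : ∀ μ, 0 ≤ μ → D μ ≤ μ * M := fun μ hμ => h.angle_one_le hμ (hΘ μ hμ)
  have hm := h.pos
  have hM := h.upper_pos
  have hD0 : D 0 = 0 := le_antisymm (by simpa using hupp 0 le_rfl) (by simpa using hlow 0 le_rfl)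
  have hex : ∀ c > 0, ∃ μ, 0 < μ ∧ D μ = c := by
    intro c hc
    have hcm : 0 ≤ c / m := by positivity
    have hsub : c ∈ Icc (D 0) (D (c / m)) :=
      ⟨hD0.le.trans hc.le, by simpa [div_mul_cancel₀ c hm.ne'] using hlow (c / m) hcm⟩
    obtain ⟨μ, hμ, rfl⟩ := intermediate_value_Icc hcm (hcont.mono Icc_subset_Ici_self) hsub
    refine ⟨μ, hμ.1.lt_of_ne ?_, rfl⟩
    rintro rfl
    exact hc.ne' hD0
  choose! E hE0 hE using hex
  refine ⟨E, fun c hc => ⟨hE0 c hc, ?_, ?_⟩, ?_, ?_⟩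
  · rw [div_le_iff₀ hM]; simpa [hE c hc] using hupp (E c) (hE0 c hc).le
  · rw [le_div_iff₀ hm]; simpa [hE c hc] using hlow (E c) (hE0 c hc).le
  · intro c hc d hd hcd
    have hc : 0 < c := hc
    have hd : 0 < d := hd
    rw [← hmono.lt_iff_lt (hE0 c hc).le (hE0 d hd).le, hE c hc, hE d hd]
    exact hcd
  · intro μ hμ c hc θ hθ
    rw [h.eq_of_isAngle hμ.le hθ (hΘ μ hμ.le) (right_mem_Icc.2 zero_le_one)]
    show D μ = c ↔ _
    conv_lhs => rw [← hE c hc]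
    exact hmono.injOn.eq_iff hμ.le (hE0 c hc).le

end AngleData

end Angle

/-! ### Solutions with a prescribed Prüfer angle, and the first-order system -/

section Weighted

variable {p μ l : ℝ} {q θ : ℝ → ℝ}

lemma hasDerivAt_abs_pSin_rpow (hp : 2 ≤ p) (θ : ℝ) :
    HasDerivAt (fun x => |pSin p x| ^ p) (p * oddPow (p - 1) (pSin p θ) * pCos p θ) θ :=
  (hasDerivAt_abs_rpow_oddPow (by linarith) (pSin p θ)).comp θ (hasDerivAt_pSin hp θ)

lemma abs_pSin_le_one (hp : 2 ≤ p) (θ : ℝ) : |pSin p θ| ≤ 1 := by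
  rw [pSin, abs_oddPow (by positivity)]
  exact Real.rpow_le_one (abs_nonneg _) (Real.abs_sin_le_one _) (by positivity)

lemma abs_pCos_le_one (hp : 2 ≤ p) (θ : ℝ) : |pCos p θ| ≤ 1 := by
  rw [pCos, abs_oddPow (by positivity)]
  exact Real.rpow_le_one (abs_nonneg _) (Real.abs_cos_le_one _) (by positivity)

lemma lipschitzWith_abs_pSin_rpow (hp : 2 ≤ p) :
    LipschitzWith p.toNNReal fun x => |pSin p x| ^ p := by
  refine lipschitzWith_of_nnnorm_deriv_le
    (fun x => (hasDerivAt_abs_pSin_rpow hp x).differentiableAt) fun x => ?_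
  rw [(hasDerivAt_abs_pSin_rpow hp x).deriv, ← NNReal.coe_le_coe, coe_nnnorm, Real.norm_eq_abs,
    Real.coe_toNNReal _ (by linarith), abs_mul, abs_mul, abs_of_pos (by linarith : 0 < p),
    abs_oddPow (by linarith)]
  have h1 : |pSin p x| ^ (p - 1) ≤ 1 :=
    Real.rpow_le_one (abs_nonneg _) (abs_pSin_le_one hp x) (by linarith)
  have h2 := abs_pCos_le_one hp x
  calc p * |pSin p x| ^ (p - 1) * |pCos p x| ≤ p * 1 * 1 := by gcongr
    _ = p := by ring

lemma angleData_abs_pSin_rpow (hp : 2 ≤ p) {m M : ℝ} (hq : ContinuousOn q (Icc 0 1)) (hm : 0 < m)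
    (hmq : ∀ t ∈ Icc (0 : ℝ) 1, m ≤ q t) (hqM : ∀ t ∈ Icc (0 : ℝ) 1, q t ≤ M) (hm1 : m ≤ 1)
    (hM1 : 1 ≤ M) : AngleData (fun x => |pSin p x| ^ p) q p.toNNReal m M where
  lipschitz := lipschitzWith_abs_pSin_rpow hp
  nonneg _ := by positivity
  le_one x := Real.rpow_le_one (abs_nonneg _) (abs_pSin_le_one hp x) (by linarith)
  continuousOn := hq
  pos := hm
  le_weight := hmq
  weight_le := hqM
  lower_le_one := hm1
  one_le_upper := hM1

lemma pSin_halfPeriod_div_two_ne_zero (hp : 2 ≤ p) : pSin p (halfPeriod p / 2) ≠ 0 := by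
  rw [Ne, pSin_eq_zero_iff hp]
  rintro ⟨k, hk⟩
  have h1 : (k : ℝ) = 1 / 2 := by
    have := halfPeriod_pos hp
    field_simp at hk ⊢
    linarith
  have h2 : ((2 * k : ℤ) : ℝ) = (1 : ℤ) := by push_cast; linarith
  have h3 : 2 * k = 1 := by exact_mod_cast h2
  omega

lemma oddPow_pos_mul {e x : ℝ} (he : e ≠ 0) (hx : 0 ≤ x) (y : ℝ) :
    oddPow e (x * y) = x ^ e * oddPow e y := by
  rw [oddPow_mul, oddPow_of_nonneg he hx]

/-- If the terminal angle is a multiple of the half period, then `v = e^R S(θ)` is an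
eigenfunction, where the logarithmic radius `R` is the primitive of `μ (1 - q) |S|^(p-2) S C`. -/
theorem isWeightedEigenfunction_of_isAngle (hp : 2 ≤ p) (hq : ContinuousOn q (Icc 0 1))
    (hμ : 0 < μ) (hθ : IsAngle (fun x => |pSin p x| ^ p) q μ θ) {k : ℕ} (hk : 1 ≤ k)
    (hθ1 : θ 1 = k * halfPeriod p) : ∃ v, IsWeightedEigenfunction p q ((p - 1) * μ ^ p) v := by
  set Φ : ℝ → ℝ := fun t => μ * (1 - q t) * oddPow (p - 1) (pSin p (θ t)) * pCos p (θ t) with hΦ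
  have hφ : Continuous fun x => oddPow (p - 1) (pSin p x) :=
    (continuous_oddPow (by linarith)).comp (continuous_pSin hp)
  have hΦc : ContinuousOn Φ (Icc 0 1) :=
    ((continuousOn_const.mul (continuousOn_const.sub hq)).mul
      (hφ.comp_continuousOn hθ.continuousOn)).mul
      ((continuous_pCos hp).comp_continuousOn hθ.continuousOn)
  -- `Φ` is continuous on `[0, 1]` only; `projIcc` extends it to `ℝ`, so that its primitive is
  -- differentiable at the end points too.
  have hΦe : Continuous fun t => Φ (projIcc (0 : ℝ) 1 zero_le_one t) :=
    hΦc.comp_continuous (continuous_subtype_val.comp continuous_projIcc) fun t => Subtype.prop _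
  set R : ℝ → ℝ := fun t => ∫ s in (0 : ℝ)..t, Φ (projIcc (0 : ℝ) 1 zero_le_one s) with hR
  have hRd : ∀ t ∈ Icc (0 : ℝ) 1, HasDerivAt R (Φ t) t := by
    intro t ht
    have := (hΦe.integral_hasStrictDerivAt 0 t).hasDerivAt
    rwa [projIcc_of_mem _ ht] at this
  have hθd : ∀ t ∈ Ioo (0 : ℝ) 1,
      HasDerivAt θ (μ * (1 + (q t - 1) * |pSin p (θ t)| ^ p)) t := fun t ht =>
    (hθ.hasDerivWithinAt t (Ioo_subset_Icc_self ht)).hasDerivAt (Icc_mem_nhds ht.1 ht.2)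
  have hSS : ∀ x, oddPow (p - 1) (pSin p x) * pSin p x = |pSin p x| ^ p := fun x => by
    rw [oddPow_mul_self (by linarith)]; congr 1; ring
  have hCC : ∀ x, pCosPow p x * pCos p x = 1 - |pSin p x| ^ p := fun x => by
    rw [pCosPow, oddPow_mul_self (by linarith), ← abs_pSin_rpow_add_abs_pCos_rpow hp x]; ring_nf
  have hvd : ∀ t ∈ Ioo (0 : ℝ) 1, HasDerivAt (fun t => Real.exp (R t) * pSin p (θ t))
      (μ * Real.exp (R t) * pCos p (θ t)) t := by
    intro t ht
    have h1 := (hRd t (Ioo_subset_Icc_self ht)).exp.mul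
      ((hasDerivAt_pSin hp (θ t)).comp t (hθd t ht))
    refine h1.congr_deriv ?_
    simp only [hΦ, Function.comp]
    linear_combination Real.exp (R t) * μ * pCos p (θ t) * (1 - q t) * hSS (θ t)
  refine ⟨fun t => Real.exp (R t) * pSin p (θ t), ?_, fun t ht => (hvd t ht).differentiableAt,
    fun t ht => ?_, ?_, ?_, ?_⟩
  · exact (Real.continuous_exp.comp_continuousOn
      fun t ht => (hRd t ht).continuousAt.continuousWithinAt).mul
      ((continuous_pSin hp).comp_continuousOn hθ.continuousOn)
  · have h1 : HasDerivAt (fun s => μ ^ (p - 1) * Real.exp ((p - 1) * R s) * pCosPow p (θ s))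
        (-((p - 1) * μ ^ p * q t * (|Real.exp (R t) * pSin p (θ t)| ^ (p - 2) *
          (Real.exp (R t) * pSin p (θ t))))) t := by
      have h2 := ((((hRd t (Ioo_subset_Icc_self ht)).const_mul (p - 1)).exp).const_mul
        (μ ^ (p - 1))).mul ((hasDerivAt_pCosPow hp (θ t)).comp t (hθd t ht))
      refine h2.congr_deriv ?_
      have h3 : |Real.exp (R t) * pSin p (θ t)| ^ (p - 2) * (Real.exp (R t) * pSin p (θ t)) =
          Real.exp ((p - 1) * R t) * oddPow (p - 1) (pSin p (θ t)) := by
        have : |Real.exp (R t) * pSin p (θ t)| ^ (p - 2) * (Real.exp (R t) * pSin p (θ t)) =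
          oddPow (p - 1) (Real.exp (R t) * pSin p (θ t)) := by rw [oddPow]; congr 2; ring
        rw [this, oddPow_pos_mul (by linarith) (Real.exp_pos _).le, ← Real.exp_mul, mul_comm (R t)]
      have h4 : μ ^ p = μ ^ (p - 1) * μ := by
        rw [← Real.rpow_add_one hμ.ne']; congr 1; ring
      rw [h3, h4]
      simp only [hΦ, Function.comp]
      linear_combination μ ^ (p - 1) * Real.exp ((p - 1) * R t) * (p - 1) * μ * (1 - q t) *
        oddPow (p - 1) (pSin p (θ t)) * hCC (θ t)
    refine h1.congr_of_eventuallyEq ?_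
    filter_upwards [Ioo_mem_nhds ht.1 ht.2] with s hs
    have h5 : |deriv (fun t => Real.exp (R t) * pSin p (θ t)) s| ^ (p - 2) *
        deriv (fun t => Real.exp (R t) * pSin p (θ t)) s =
        oddPow (p - 1) (μ * Real.exp (R s) * pCos p (θ s)) := by
      rw [(hvd s hs).deriv, oddPow]; congr 2; ring
    rw [h5, oddPow_pos_mul (by linarith) (by positivity), Real.mul_rpow hμ.le (Real.exp_pos _).le,
      ← Real.exp_mul, mul_comm (R s), pCosPow]
  · have : pSin p (θ 0) = 0 := (pSin_eq_zero_iff hp).2 ⟨0, by simp [hθ.zero]⟩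
    simp [this]
  · have : pSin p (θ 1) = 0 := (pSin_eq_zero_iff hp).2 ⟨k, by simp [hθ1]⟩
    simp [this]
  · have hϖ := halfPeriod_pos hp
    have hk' : (1 : ℝ) ≤ k := by exact_mod_cast hk
    have hmem : halfPeriod p / 2 ∈ Ioo (θ 0) (θ 1) := by
      rw [hθ.zero, hθ1]; constructor <;> nlinarith
    obtain ⟨t, ht, htθ⟩ := intermediate_value_Ioo zero_le_one hθ.continuousOn hmem
    refine ⟨t, ht, mul_ne_zero (Real.exp_pos _).ne' ?_⟩
    rw [htθ]
    exact pSin_halfPeriod_div_two_ne_zero hp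

/-- An eigenfunction coincides on `[0, 1]` with the first component of a solution of the first-order
system `V' = |W|^(1/(p-1) - 1) W`, `W' = -l q |V|^(p-2) V` that is regular up to the end points.
There `W` is the flux `|v'|^(p-2) v'`, extended from `(0, 1)` by integrating its derivative. -/
theorem IsWeightedEigenfunction.exists_system (hp : 2 ≤ p) (hq : ContinuousOn q (Icc 0 1))
    {v : ℝ → ℝ} (hv : IsWeightedEigenfunction p q l v) :
    ∃ V W : ℝ → ℝ, (∀ t, HasDerivAt V (oddPow (1 / (p - 1)) (W t)) t) ∧
      (∀ t ∈ Icc (0 : ℝ) 1, HasDerivAt W (-(l * q t * oddPow (p - 1) (V t))) t) ∧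
      V 0 = 0 ∧ V 1 = 0 ∧ ∃ t ∈ Icc (0 : ℝ) 1, V t ≠ 0 := by
  have hp1 : 0 < p - 1 := by linarith
  set g : ℝ → ℝ := fun t => -(l * q t * oddPow (p - 1) (v t)) with hg
  have hgc : ContinuousOn g (Icc 0 1) :=
    ((continuousOn_const.mul hq).mul
      ((continuous_oddPow hp1).comp_continuousOn hv.continuousOn)).neg
  -- `projIcc` extends `g` continuously beyond the end points, where nothing is known about `v`.
  have hge : Continuous fun t => g (projIcc (0 : ℝ) 1 zero_le_one t) :=
    hgc.comp_continuous (continuous_subtype_val.comp continuous_projIcc) fun t => Subtype.prop _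
  have hflux : ∀ s, |deriv v s| ^ (p - 2) * deriv v s = oddPow (p - 1) (deriv v s) := fun s => by
    rw [oddPow]; congr 2; ring
  have hhalf : (1 / 2 : ℝ) ∈ Ioo (0 : ℝ) 1 := by constructor <;> norm_num
  set W : ℝ → ℝ := fun t => oddPow (p - 1) (deriv v (1 / 2)) +
    ∫ s in (1 / 2 : ℝ)..t, g (projIcc (0 : ℝ) 1 zero_le_one s) with hW
  have hWd : ∀ t ∈ Icc (0 : ℝ) 1, HasDerivAt W (g t) t := by
    intro t ht
    have := ((hge.integral_hasStrictDerivAt (1 / 2) t).hasDerivAt).const_add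
      (oddPow (p - 1) (deriv v (1 / 2)))
    rwa [projIcc_of_mem _ ht] at this
  have hWc : Continuous W := by
    refine continuous_const.add ?_
    exact continuous_iff_continuousAt.2 fun t =>
      (hge.integral_hasStrictDerivAt (1 / 2) t).hasDerivAt.continuousAt
  have hwd : ∀ t ∈ Ioo (0 : ℝ) 1, HasDerivAt (fun s => oddPow (p - 1) (deriv v s)) (g t) t := by
    intro t ht
    have := hv.equation t ht
    simp only [hflux] at this
    refine this.congr_deriv ?_
    simp only [hg, oddPow]; congr 4; ring
  have hweq : EqOn (fun s => oddPow (p - 1) (deriv v s)) W (Ioo 0 1) := by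
    refine isOpen_Ioo.eqOn_of_deriv_eq isPreconnected_Ioo
      (fun t ht => (hwd t ht).differentiableAt.differentiableWithinAt)
      (fun t ht => (hWd t (Ioo_subset_Icc_self ht)).differentiableAt.differentiableWithinAt)
      (fun t ht => ?_) hhalf ?_
    · rw [(hwd t ht).deriv, (hWd t (Ioo_subset_Icc_self ht)).deriv]
    · simp [hW]
  have hψc : Continuous fun t => oddPow (1 / (p - 1)) (W t) :=
    (continuous_oddPow (by positivity)).comp hWc
  have hvd : ∀ t ∈ Ioo (0 : ℝ) 1, HasDerivAt v (oddPow (1 / (p - 1)) (W t)) t := by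
    intro t ht
    rw [← hweq ht, oddPow_oddPow, mul_one_div_cancel hp1.ne', oddPow_one]
    exact (hv.differentiableAt t ht).hasDerivAt
  set V : ℝ → ℝ := fun t => ∫ s in (0 : ℝ)..t, oddPow (1 / (p - 1)) (W s) with hV
  have hVv : ∀ t ∈ Icc (0 : ℝ) 1, V t = v t := by
    intro t ht
    have := intervalIntegral.integral_eq_sub_of_hasDerivAt_of_le ht.1
      (hv.continuousOn.mono (Icc_subset_Icc_right ht.2))
      (fun s hs => hvd s ⟨hs.1, hs.2.trans_le ht.2⟩) (hψc.intervalIntegrable _ _)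
    rw [hV]
    simp only [this, hv.left, sub_zero]
  refine ⟨V, W, fun t => (hψc.integral_hasStrictDerivAt 0 t).hasDerivAt, fun t ht => ?_, ?_, ?_, ?_⟩
  · rw [hVv t ht]; exact hWd t ht
  · rw [hVv 0 (by simp), hv.left]
  · rw [hVv 1 (by simp), hv.right]
  · obtain ⟨t, ht, h⟩ := hv.nontrivial
    exact ⟨t, Ioo_subset_Icc_self ht, by rwa [hVv t (Ioo_subset_Icc_self ht)]⟩

/-- If `l ≤ 0`, then `V W` is nondecreasing and vanishes at both ends, hence everywhere; its
derivative dominates a positive power of `|W|`, so `W = 0` and `V` is constant. -/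
theorem IsWeightedEigenfunction.eigenvalue_pos (hp : 2 ≤ p) (hq : ContinuousOn q (Icc 0 1))
    (hq0 : ∀ t ∈ Icc (0 : ℝ) 1, 0 ≤ q t) {v : ℝ → ℝ} (hv : IsWeightedEigenfunction p q l v) :
    0 < l := by
  by_contra! hl
  have hp1 : 0 < p - 1 := by linarith
  obtain ⟨V, W, hV, hW, hV0, hV1, t₀, ht₀, hne⟩ := hv.exists_system hp hq
  have hd : ∀ t ∈ Icc (0 : ℝ) 1, HasDerivAt (fun t => V t * W t)
      (|W t| ^ (1 / (p - 1) + 1) - l * q t * |V t| ^ p) t := by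
    intro t ht
    refine ((hV t).mul (hW t ht)).congr_deriv ?_
    have e1 := oddPow_mul_self (e := 1 / (p - 1)) (by positivity) (W t)
    have e2 := oddPow_mul_self (e := p - 1) (by linarith) (V t)
    rw [sub_add_cancel] at e2
    rw [← e1, ← e2]; ring
  have hlq : ∀ t ∈ Icc (0 : ℝ) 1, 0 ≤ -(l * q t * |V t| ^ p) := fun t ht => by
    have := mul_nonneg (mul_nonneg (neg_nonneg.2 hl) (hq0 t ht))
      (Real.rpow_nonneg (abs_nonneg (V t)) p)
    linarith
  have hmono : MonotoneOn (fun t => V t * W t) (Icc 0 1) := by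
    refine monotoneOn_of_deriv_nonneg (convex_Icc 0 1)
      (fun t ht => (hd t ht).continuousAt.continuousWithinAt)
      (fun t ht => (hd t (interior_subset ht)).differentiableAt.differentiableWithinAt)
      fun t ht => ?_
    rw [(hd t (interior_subset ht)).deriv]
    have := hlq t (interior_subset ht)
    have : 0 ≤ |W t| ^ (1 / (p - 1) + 1) := by positivity
    linarith
  have hzero : ∀ t ∈ Icc (0 : ℝ) 1, V t * W t = 0 := by
    intro t ht
    have h1 := hmono (left_mem_Icc.2 zero_le_one) ht ht.1
    have h2 := hmono ht (right_mem_Icc.2 zero_le_one) ht.2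
    simp only [hV0, hV1, zero_mul] at h1 h2
    exact le_antisymm h2 h1
  have hW0 : ∀ t ∈ Ioo (0 : ℝ) 1, W t = 0 := by
    intro t ht
    have h0 : HasDerivAt (fun t => V t * W t) 0 t :=
      (hasDerivAt_const t (0 : ℝ)).congr_of_eventuallyEq <| by
        filter_upwards [Icc_mem_nhds ht.1 ht.2] with s hs using hzero s hs
    have h1 := (hd t (Ioo_subset_Icc_self ht)).unique h0
    have h2 := hlq t (Ioo_subset_Icc_self ht)
    by_contra hW
    have : 0 < |W t| ^ (1 / (p - 1) + 1) := Real.rpow_pos_of_pos (abs_pos.2 hW) _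
    linarith
  have hVc : Continuous V := continuous_iff_continuousAt.2 fun t => (hV t).continuousAt
  have hconst := constant_of_has_deriv_right_zero (a := 0) (b := t₀) hVc.continuousOn
    (f := V) fun t ht => by
      rcases ht.1.eq_or_lt with rfl | h0
      · have hWc : ContinuousWithinAt W (Ioo 0 1) 0 :=
          (hW 0 (by simp)).continuousAt.continuousWithinAt
        have : W 0 = 0 := by
          have hne : (𝓝[Ioo (0 : ℝ) 1] 0).NeBot := left_nhdsWithin_Ioo_neBot zero_lt_one
          refine tendsto_nhds_unique hWc.tendsto (tendsto_const_nhds.congr' ?_)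
          filter_upwards [self_mem_nhdsWithin] with s hs using (hW0 s hs).symm
        have h := (hV 0).hasDerivWithinAt (s := Ici 0)
        rwa [this, oddPow_zero] at h
      · have h := (hV t).hasDerivWithinAt (s := Ici t)
        rwa [hW0 t ⟨h0, ht.2.trans_le ht₀.2⟩, oddPow_zero] at h
  exact hne ((hconst t₀ (right_mem_Icc.2 ht₀.1)).trans hV0)

/-! ### The Prüfer angle of a solution -/

/-- A continuous curve on the unit circle has a continuous angle. -/
lemma exists_continuous_sin_cos_eq {u w : ℝ → ℝ} (hu : ContinuousOn u (Icc 0 1))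
    (hw : ContinuousOn w (Icc 0 1)) (huw : ∀ t ∈ Icc (0 : ℝ) 1, u t ^ 2 + w t ^ 2 = 1) :
    ∃ α : ℝ → ℝ, Continuous α ∧
      ∀ t ∈ Icc (0 : ℝ) 1, Real.sin (α t) = u t ∧ Real.cos (α t) = w t := by
  have hmem : ∀ t : unitInterval, (⟨w t, u t⟩ : ℂ) ∈ Submonoid.unitSphere ℂ := fun t => by
    rw [Submonoid.unitSphere, Submonoid.mem_mk, Subsemigroup.mem_mk,
      mem_sphere_zero_iff_norm,
      Complex.norm_def, Complex.normSq_mk, Real.sqrt_eq_one]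
    linarith [huw t t.2]
  have hc : Continuous fun t : unitInterval => (⟨⟨w t, u t⟩, hmem t⟩ : Circle) := by
    refine Continuous.subtype_mk ?_ _
    have h1 : Continuous fun t : unitInterval => (w t : ℂ) + (u t : ℂ) * Complex.I :=
      (Complex.continuous_ofReal.comp hw.domRestrict).add
        ((Complex.continuous_ofReal.comp hu.domRestrict).mul continuous_const)
    convert h1 using 2 with t
    exact Complex.mk_eq_add_mul_I _ _
  obtain ⟨e, he⟩ : ∃ e : ℝ, Circle.exp e = ⟨⟨w (0 : unitInterval), u (0 : unitInterval)⟩, hmem 0⟩ :=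
    ⟨_, Circle.exp_arg _⟩
  obtain ⟨Γ, hΓ, -⟩ := Circle.isCoveringMap_exp.exists_path_lifts ⟨_, hc⟩ e he.symm
  refine ⟨IccExtend zero_le_one Γ, Γ.continuous.Icc_extend', fun t ht => ?_⟩
  rw [IccExtend_of_mem _ _ ht]
  have h1 : (Circle.exp (Γ ⟨t, ht⟩) : ℂ) = ⟨w t, u t⟩ := congrArg Subtype.val (congrFun hΓ ⟨t, ht⟩)
  rw [Circle.coe_exp] at h1
  constructor
  · rw [← Complex.exp_ofReal_mul_I_im, h1]
  · rw [← Complex.exp_ofReal_mul_I_re, h1]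

/-- If `f ∘ θ` is differentiable, `θ` is continuous and `f'` does not vanish, then `θ` is
differentiable with the derivative that the chain rule predicts. -/
lemma hasDerivWithinAt_of_comp {f θ : ℝ → ℝ} {f' g' x : ℝ} {s : Set ℝ} (hf : ContDiff ℝ 1 f)
    (hf' : HasDerivAt f f' (θ x)) (hne : f' ≠ 0) (hθ : ContinuousWithinAt θ s x)
    (h : HasDerivWithinAt (fun t => f (θ t)) (f' * g') s x) : HasDerivWithinAt θ g' s x := by
  have hs : HasStrictDerivAt f f' (θ x) :=
    hf.contDiffAt.hasStrictDerivAt' hf' one_ne_zero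
  have hinv := (hs.to_localInverse hne).hasDerivAt
  have hcomp := hinv.comp_hasDerivWithinAt x (h₂ := hs.localInverse f f' (θ x) hne)
    (h := fun t => f (θ t)) h
  have hev : ∀ᶠ y in 𝓝 (θ x), hs.localInverse f f' (θ x) hne (f y) = y :=
    (hs.hasStrictFDerivAt_equiv hne).eventually_left_inverse
  have hev' := hθ.tendsto.eventually hev
  refine (hcomp.congr_of_eventuallyEq (hev'.mono fun t ht => ht.symm)
    hev.self_of_nhds.symm).congr_deriv ?_
  field_simp

lemma contDiff_pSin (hp : 2 ≤ p) : ContDiff ℝ 1 (pSin p) := by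
  rw [contDiff_one_iff_deriv]
  refine ⟨fun x => (hasDerivAt_pSin hp x).differentiableAt, ?_⟩
  rw [show deriv (pSin p) = pCos p from funext fun x => (hasDerivAt_pSin hp x).deriv]
  exact continuous_pCos hp

lemma contDiff_pCosPow (hp : 2 ≤ p) : ContDiff ℝ 1 (pCosPow p) := by
  rw [contDiff_one_iff_deriv]
  refine ⟨fun x => (hasDerivAt_pCosPow hp x).differentiableAt, ?_⟩
  rw [show deriv (pCosPow p) = fun x => -((p - 1) * oddPow (p - 1) (pSin p x)) from
    funext fun x => (hasDerivAt_pCosPow hp x).deriv]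
  exact (((continuous_oddPow (by linarith)).comp (continuous_pSin hp)).const_mul _).neg

lemma toAngle_add_int_mul_pi (hp : 2 ≤ p) (α : ℝ) (k : ℤ) :
    toAngle p (α + k * Real.pi) = toAngle p α + k * halfPeriod p := by
  have h1 := (angleDensity_periodic p).intervalIntegral_add_zsmul_eq k α
    (intervalIntegrable_angleDensity hp)
  have h2 := (angleDensity_periodic p).intervalIntegral_add_eq α 0
  rw [h2, zero_add] at h1
  simp only [zsmul_eq_mul] at h1
  rw [toAngle, toAngle, halfPeriod, ← h1, intervalIntegral.integral_add_adjacent_intervals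
    (intervalIntegrable_angleDensity hp _ _) (intervalIntegrable_angleDensity hp _ _)]

lemma abs_pSin_sub_int_mul_halfPeriod (hp : 2 ≤ p) (θ : ℝ) (k : ℤ) :
    |pSin p (θ - k * halfPeriod p)| ^ p = |pSin p θ| ^ p := by
  have h : ofAngle p (θ - k * halfPeriod p) = ofAngle p θ - k * Real.pi := by
    apply (strictMono_toAngle hp).injective
    have := toAngle_add_int_mul_pi hp (ofAngle p θ - k * Real.pi) k
    rw [sub_add_cancel, toAngle_ofAngle hp] at this
    rw [toAngle_ofAngle hp]
    linarith
  rw [abs_pSin_rpow hp, abs_pSin_rpow hp, h, Real.sin_sub_int_mul_pi, mul_pow]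
  rcases Int.even_or_odd k with h | h <;> simp [h.neg_one_zpow]

/-- A nonnegative function with `|E'| ≤ K E` that vanishes at one point vanishes identically, since
`E e^(K t)` is nondecreasing and `E e^(-K t)` nonincreasing. -/
lemma eq_zero_of_abs_deriv_le {E E' : ℝ → ℝ} {K t₀ : ℝ}
    (hE : ∀ t ∈ Icc (0 : ℝ) 1, HasDerivAt E (E' t) t) (h0 : ∀ t ∈ Icc (0 : ℝ) 1, 0 ≤ E t)
    (hK : ∀ t ∈ Icc (0 : ℝ) 1, |E' t| ≤ K * E t) (ht₀ : t₀ ∈ Icc (0 : ℝ) 1) (hz : E t₀ = 0) :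
    ∀ t ∈ Icc (0 : ℝ) 1, E t = 0 := by
  have hd : ∀ c, ∀ t ∈ Icc (0 : ℝ) 1,
      HasDerivAt (fun t => E t * Real.exp (c * t)) ((E' t + c * E t) * Real.exp (c * t)) t := by
    intro c t ht
    have h1 := (hE t ht).mul ((hasDerivAt_id t).const_mul c).exp
    refine h1.congr_deriv ?_
    simp only [id]
    ring
  have hmono : MonotoneOn (fun t => E t * Real.exp (K * t)) (Icc 0 1) := by
    refine monotoneOn_of_deriv_nonneg (convex_Icc 0 1)
      (fun t ht => (hd K t ht).continuousAt.continuousWithinAt)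
      (fun t ht => (hd K t (interior_subset ht)).differentiableAt.differentiableWithinAt)
      fun t ht => ?_
    rw [(hd K t (interior_subset ht)).deriv]
    exact mul_nonneg (by linarith [(abs_le.1 (hK t (interior_subset ht))).1]) (Real.exp_pos _).le
  have hanti : AntitoneOn (fun t => E t * Real.exp (-K * t)) (Icc 0 1) := by
    refine antitoneOn_of_deriv_nonpos (convex_Icc 0 1)
      (fun t ht => (hd (-K) t ht).continuousAt.continuousWithinAt)
      (fun t ht => (hd (-K) t (interior_subset ht)).differentiableAt.differentiableWithinAt)
      fun t ht => ?_
    rw [(hd (-K) t (interior_subset ht)).deriv]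
    exact mul_nonpos_of_nonpos_of_nonneg
      (by linarith [(abs_le.1 (hK t (interior_subset ht))).2]) (Real.exp_pos _).le
  intro t ht
  refine le_antisymm ?_ (h0 t ht)
  rcases le_total t t₀ with h | h
  · have := hmono ht ht₀ h
    simp only [hz, zero_mul] at this
    exact nonpos_of_mul_nonpos_left this (Real.exp_pos _)
  · have := hanti ht₀ ht h
    simp only [hz, zero_mul] at this
    exact nonpos_of_mul_nonpos_left this (Real.exp_pos _)

lemma rpow_mul_le_add {x z p : ℝ} (hx : 0 ≤ x) (hz : 0 ≤ z) (hp : 1 < p) :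
    x ^ (p - 1) * z ≤ x ^ p + z ^ p := by
  have hxp : x ^ (p - 1) * x = x ^ p := by
    rw [← Real.rpow_add_one' hx (by linarith), sub_add_cancel]
  have hzp : z ^ (p - 1) * z = z ^ p := by
    rw [← Real.rpow_add_one' hz (by linarith), sub_add_cancel]
  have h1 := Real.rpow_nonneg hx p
  have h2 := Real.rpow_nonneg hz p
  rcases le_total z x with h | h
  · have : x ^ (p - 1) * z ≤ x ^ (p - 1) * x := by gcongr
    linarith
  · have : x ^ (p - 1) * z ≤ z ^ (p - 1) * z := by
      gcongr
    linarith

/-- A nontrivial solution of the first-order system that vanishes at both ends has a Prüfer angle,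
and the terminal angle is a multiple of the half period.

The energy `E = |X|^p + |Z|^p`, with `Z` the odd power `1/(p-1)` of `Y`, has `|E'| ≤ K E` and so
never vanishes. The curve `(X, Z) / E^(1/p)` therefore lies on `|x|^p + |y|^p = 1`, and its
Euclidean angle lifts. The lift is only known to be continuous; its differentiability follows from
that of `S(θ)` and of `|C|^(p-2) C (θ)`, whose derivatives with respect to `θ` have no common
zero. -/
theorem exists_isAngle_of_system (hp : 2 ≤ p) {X Y : ℝ → ℝ} {M : ℝ} (hμ : 0 < μ)
    (hq0 : ∀ t ∈ Icc (0 : ℝ) 1, 0 ≤ q t) (hqM : ∀ t ∈ Icc (0 : ℝ) 1, q t ≤ M) (hM1 : 1 ≤ M)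
    (hX : ∀ t, HasDerivAt X (μ * oddPow (1 / (p - 1)) (Y t)) t)
    (hY : ∀ t ∈ Icc (0 : ℝ) 1, HasDerivAt Y (-((p - 1) * μ * q t * oddPow (p - 1) (X t))) t)
    (hX0 : X 0 = 0) (hX1 : X 1 = 0) (hne : ∃ t ∈ Icc (0 : ℝ) 1, X t ≠ 0) :
    ∃ (θ : ℝ → ℝ) (k : ℤ), IsAngle (fun x => |pSin p x| ^ p) q μ θ ∧ θ 1 = k * halfPeriod p := by
  have hp0 : 0 < p := by linarith
  have hp1 : 0 < p - 1 := by linarith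
  set Z : ℝ → ℝ := fun t => oddPow (1 / (p - 1)) (Y t) with hZ
  have hYZ : ∀ t, Y t = oddPow (p - 1) (Z t) := fun t => by
    rw [hZ, oddPow_oddPow, one_div_mul_cancel hp1.ne', oddPow_one]
  set E : ℝ → ℝ := fun t => |X t| ^ p + |Z t| ^ p with hEdef
  have hE0 : ∀ t, 0 ≤ E t := fun t => by positivity
  have hZp : ∀ t, |Z t| ^ p = |Y t| ^ (p / (p - 1)) := fun t => by
    rw [hZ, abs_oddPow (by positivity), ← Real.rpow_mul (abs_nonneg _)]; congr 1; field_simp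
  have hEd : ∀ t ∈ Icc (0 : ℝ) 1,
      HasDerivAt E (p * μ * (1 - q t) * (oddPow (p - 1) (X t) * Z t)) t := by
    intro t ht
    have h1 := (hasDerivAt_abs_rpow_oddPow (p := p) (by linarith) (X t)).comp t (hX t)
    have h2 := (hasDerivAt_abs_rpow_oddPow (p := p / (p - 1))
      (by rw [lt_div_iff₀ hp1]; linarith) (Y t)).comp t (hY t ht)
    have h3 := h1.add h2
    have hfun : E = (fun y => |y| ^ p) ∘ X + (fun y => |y| ^ (p / (p - 1))) ∘ Y := by
      funext s
      simp only [hEdef, hZp, Pi.add_apply, Function.comp]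
    rw [hfun]
    refine h3.congr_deriv ?_
    have e1 : p / (p - 1) - 1 = 1 / (p - 1) := by field_simp; ring
    rw [e1]
    simp only [hZ]
    field_simp
    ring
  have hEpos : ∀ t ∈ Icc (0 : ℝ) 1, 0 < E t := by
    intro t ht
    refine (hE0 t).lt_of_ne' fun hz => ?_
    obtain ⟨s, hs, hXs⟩ := hne
    have := eq_zero_of_abs_deriv_le (K := p * μ * M) hEd (fun t _ => hE0 t) (fun t ht => by
      have e1 : |oddPow (p - 1) (X t) * Z t| ≤ E t := by
        rw [abs_mul, abs_oddPow hp1.ne']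
        exact rpow_mul_le_add (abs_nonneg _) (abs_nonneg _) (by linarith)
      have e2 : |1 - q t| ≤ M := by
        rw [abs_le]; constructor <;> linarith [hq0 t ht, hqM t ht]
      rw [abs_mul, abs_mul, abs_of_pos (mul_pos hp0 hμ)]
      gcongr) ht hz s hs
    have h1 : 0 < |X s| ^ p := Real.rpow_pos_of_pos (abs_pos.2 hXs) _
    have h2 : 0 ≤ |Z s| ^ p := by positivity
    simp only [hEdef] at this
    linarith
  set r : ℝ → ℝ := fun t => E t ^ (1 / p) with hr
  have hrpos : ∀ t ∈ Icc (0 : ℝ) 1, 0 < r t := fun t ht => Real.rpow_pos_of_pos (hEpos t ht) _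
  have hrp : ∀ t ∈ Icc (0 : ℝ) 1, r t ^ p = E t := fun t ht => by
    rw [hr]; simp only; rw [← Real.rpow_mul (hE0 t), one_div_mul_cancel hp0.ne', Real.rpow_one]
  have hXc : Continuous X := continuous_iff_continuousAt.2 fun t => (hX t).continuousAt
  have hYc : ContinuousOn Y (Icc 0 1) := fun t ht => (hY t ht).continuousAt.continuousWithinAt
  have hZc : ContinuousOn Z (Icc 0 1) := (continuous_oddPow (by positivity)).comp_continuousOn hYc
  have hEc : ContinuousOn E (Icc 0 1) := fun t ht => (hEd t ht).continuousAt.continuousWithinAt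
  have hrc : ContinuousOn r (Icc 0 1) := hEc.rpow_const fun t _ => Or.inr (by positivity)
  -- The map `(a, b) ↦ (oddPow (p/2) a, oddPow (p/2) b)` takes the curve `|a|^p + |b|^p = 1` to
  -- the circle.
  have hsq : ∀ y : ℝ, oddPow (p / 2) y ^ 2 = |y| ^ p := fun y => by
    rw [← sq_abs, abs_oddPow (by positivity), ← Real.rpow_natCast, ← Real.rpow_mul (abs_nonneg _)]
    congr 1; push_cast; ring
  obtain ⟨α, hα, hαsc⟩ := exists_continuous_sin_cos_eq (u := fun t => oddPow (p / 2) (X t / r t))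
    (w := fun t => oddPow (p / 2) (Z t / r t))
    ((continuous_oddPow (by positivity)).comp_continuousOn
      (hXc.continuousOn.div hrc fun t ht => (hrpos t ht).ne'))
    ((continuous_oddPow (by positivity)).comp_continuousOn
      (hZc.div hrc fun t ht => (hrpos t ht).ne'))
    (fun t ht => by
      rw [hsq, hsq, abs_div, abs_div, abs_of_pos (hrpos t ht),
        Real.div_rpow (abs_nonneg _) (hrpos t ht).le, Real.div_rpow (abs_nonneg _) (hrpos t ht).le,
        ← add_div, hrp t ht]
      exact div_self (hEpos t ht).ne')
  set ϑ : ℝ → ℝ := fun t => toAngle p (α t) with hϑ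
  have hϑc : Continuous ϑ := (continuous_toAngle hp).comp hα
  have h2p : p / 2 * (2 / p) = 1 := by field_simp
  have hS : ∀ t ∈ Icc (0 : ℝ) 1, pSin p (ϑ t) = X t / r t := fun t ht => by
    rw [pSin, hϑ, ofAngle_toAngle hp, (hαsc t ht).1, oddPow_oddPow, h2p, oddPow_one]
  have hC : ∀ t ∈ Icc (0 : ℝ) 1, pCos p (ϑ t) = Z t / r t := fun t ht => by
    rw [pCos, hϑ, ofAngle_toAngle hp, (hαsc t ht).2, oddPow_oddPow, h2p, oddPow_one]
  have hSX : ∀ t ∈ Icc (0 : ℝ) 1, X t = r t * pSin p (ϑ t) := fun t ht => by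
    rw [hS t ht, mul_div_cancel₀ _ (hrpos t ht).ne']
  have hCZ : ∀ t ∈ Icc (0 : ℝ) 1, Z t = r t * pCos p (ϑ t) := fun t ht => by
    rw [hC t ht, mul_div_cancel₀ _ (hrpos t ht).ne']
  have hφX : ∀ t ∈ Icc (0 : ℝ) 1,
      oddPow (p - 1) (X t) = r t ^ (p - 1) * oddPow (p - 1) (pSin p (ϑ t)) :=
    fun t ht => by rw [hSX t ht, oddPow_pos_mul hp1.ne' (hrpos t ht).le]
  have hTY : ∀ t ∈ Icc (0 : ℝ) 1, Y t = r t ^ (p - 1) * pCosPow p (ϑ t) := fun t ht => by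
    rw [hYZ, hCZ t ht, oddPow_pos_mul hp1.ne' (hrpos t ht).le, pCosPow]
  have hSS : ∀ x, oddPow (p - 1) (pSin p x) * pSin p x = |pSin p x| ^ p := fun x => by
    rw [oddPow_mul_self (by linarith)]; congr 1; ring
  have hCC : ∀ x, pCosPow p x * pCos p x = 1 - |pSin p x| ^ p := fun x => by
    rw [pCosPow, oddPow_mul_self (by linarith), ← abs_pSin_rpow_add_abs_pCos_rpow hp x]; ring_nf
  have hrpow : ∀ t ∈ Icc (0 : ℝ) 1, r t ^ p = r t ^ (p - 1) * r t := fun t ht => by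
    rw [← Real.rpow_add_one (hrpos t ht).ne', sub_add_cancel]
  have hrd : ∀ t ∈ Icc (0 : ℝ) 1, HasDerivAt r
      (r t * μ * (1 - q t) * oddPow (p - 1) (pSin p (ϑ t)) * pCos p (ϑ t)) t := by
    intro t ht
    refine ((hEd t ht).rpow_const (Or.inl (hEpos t ht).ne')).congr_deriv ?_
    have e1 : E t ^ (1 / p - 1) = r t / (r t ^ (p - 1) * r t) := by
      rw [← hrpow t ht, hrp t ht, Real.rpow_sub_one (hEpos t ht).ne']
    rw [e1, hφX t ht, hCZ t ht]
    have := hrpos t ht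
    have := Real.rpow_pos_of_pos this (p - 1)
    field_simp
  set F : ℝ → ℝ := fun t => μ * (1 + (q t - 1) * |pSin p (ϑ t)| ^ p) with hF
  have hSd : ∀ t ∈ Icc (0 : ℝ) 1,
      HasDerivWithinAt (fun s => pSin p (ϑ s)) (pCos p (ϑ t) * F t) (Icc 0 1) t := by
    intro t ht
    have h1 := ((hX t).div (hrd t ht) (hrpos t ht).ne').hasDerivWithinAt (s := Icc 0 1)
    refine (h1.congr (fun s hs => hS s hs) (hS t ht)).congr_deriv ?_
    have h2 := hrpos t ht
    have h3 := hCZ t ht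
    simp only [hZ] at h3
    rw [h3, hSX t ht]
    field_simp
    simp only [hF]
    linear_combination -pCos p (ϑ t) * μ * (1 - q t) * hSS (ϑ t)
  have hTd : ∀ t ∈ Icc (0 : ℝ) 1, HasDerivWithinAt (fun s => pCosPow p (ϑ s))
      (-((p - 1) * oddPow (p - 1) (pSin p (ϑ t))) * F t) (Icc 0 1) t := by
    intro t ht
    have h2 := hrpos t ht
    have h2' := Real.rpow_pos_of_pos h2 (p - 1)
    have h1 := ((hY t ht).div ((hrd t ht).rpow_const (p := p - 1) (Or.inl h2.ne'))
      h2'.ne').hasDerivWithinAt (s := Icc 0 1)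
    have hT : ∀ s ∈ Icc (0 : ℝ) 1, pCosPow p (ϑ s) = Y s / r s ^ (p - 1) := fun s hs => by
      rw [hTY s hs, mul_div_cancel_left₀ _ (Real.rpow_pos_of_pos (hrpos s hs) _).ne']
    refine (h1.congr (fun s hs => hT s hs) (hT t ht)).congr_deriv ?_
    rw [hφX t ht, hTY t ht, Real.rpow_sub_one h2.ne' (p - 1)]
    field_simp
    simp only [hF]
    linear_combination -μ * oddPow (p - 1) (pSin p (ϑ t)) * (1 - q t) * hCC (ϑ t)
  have hϑd : ∀ t ∈ Icc (0 : ℝ) 1, HasDerivWithinAt ϑ (F t) (Icc 0 1) t := by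
    intro t ht
    by_cases h : pCos p (ϑ t) = 0
    · refine hasDerivWithinAt_of_comp (contDiff_pCosPow hp) (hasDerivAt_pCosPow hp _) ?_
        hϑc.continuousWithinAt (hTd t ht)
      intro h'
      have hs : pSin p (ϑ t) = 0 := by
        rw [neg_eq_zero, mul_eq_zero] at h'
        exact oddPow_eq_zero.1 (h'.resolve_left hp1.ne')
      have := abs_pSin_rpow_add_abs_pCos_rpow hp (ϑ t)
      rw [h, hs, abs_zero, Real.zero_rpow hp0.ne'] at this
      norm_num at this
    · exact hasDerivWithinAt_of_comp (contDiff_pSin hp) (hasDerivAt_pSin hp _) h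
        hϑc.continuousWithinAt (hSd t ht)
  -- The lift starts at a multiple of the half period, not necessarily at `0`; the angle equation is
  -- invariant under the shift by it.
  obtain ⟨i, hi⟩ := (pSin_eq_zero_iff hp).1
    ((hS 0 (by simp)).trans (by rw [hX0, zero_div]))
  obtain ⟨j, hj⟩ := (pSin_eq_zero_iff hp).1
    ((hS 1 (by simp)).trans (by rw [hX1, zero_div]))
  refine ⟨fun t => ϑ t - i * halfPeriod p, j - i, ⟨by simp [hi], fun t ht => ?_⟩, ?_⟩
  · simp only [abs_pSin_sub_int_mul_halfPeriod hp]
    exact (hϑd t ht).sub_const _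
  · show ϑ 1 - _ = _
    rw [← hj]; push_cast; ring

/-- An eigenvalue is written as `(p - 1) μ^p`. Then `X = μ v` and the flux `Y` satisfy a system in
which `q` is the only coefficient that differs from that of the generalized sine run at speed `μ`.
-/
theorem IsWeightedEigenfunction.exists_isAngle (hp : 2 ≤ p) (hq : ContinuousOn q (Icc 0 1))
    {M : ℝ} (hq0 : ∀ t ∈ Icc (0 : ℝ) 1, 0 ≤ q t) (hqM : ∀ t ∈ Icc (0 : ℝ) 1, q t ≤ M)
    (hM1 : 1 ≤ M) (hμ : 0 < μ) {v : ℝ → ℝ}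
    (hv : IsWeightedEigenfunction p q ((p - 1) * μ ^ p) v) :
    ∃ (θ : ℝ → ℝ) (k : ℤ), IsAngle (fun x => |pSin p x| ^ p) q μ θ ∧ θ 1 = k * halfPeriod p := by
  obtain ⟨V, W, hV, hW, hV0, hV1, t₀, ht₀, hne⟩ := hv.exists_system hp hq
  refine exists_isAngle_of_system hp (X := fun t => μ * V t) (Y := W) hμ hq0 hqM hM1
    (fun t => (hV t).const_mul μ) (fun t ht => (hW t ht).congr_deriv ?_) (by simp [hV0])
    (by simp [hV1]) ⟨t₀, ht₀, mul_ne_zero hμ.ne' hne⟩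
  have h1 : μ ^ p = μ ^ (p - 1) * μ := by rw [← Real.rpow_add_one hμ.ne', sub_add_cancel]
  rw [oddPow_pos_mul (by linarith) hμ.le, h1]
  ring

/-! ### The spectrum of the weighted problem -/

lemma isKthSmallest_of_strictMonoOn {S : Set ℝ} {a : ℕ → ℝ} (ha : StrictMonoOn a (Ici 1))
    (hS : S = a '' Ici 1) {k : ℕ} (hk : 1 ≤ k) : IsKthSmallest S k (a k) := by
  refine ⟨hS ▸ ⟨k, hk, rfl⟩, ?_⟩
  have h1 : {m | m ∈ S ∧ m < a k} = a '' Ico 1 k := by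
    ext m
    rw [hS]
    constructor
    · rintro ⟨⟨j, hj, rfl⟩, hlt⟩
      exact ⟨j, ⟨hj, (ha.lt_iff_lt hj hk).1 hlt⟩, rfl⟩
    · rintro ⟨j, hj, rfl⟩
      exact ⟨⟨j, hj.1, rfl⟩, ha hj.1 hk hj.2⟩
  rw [h1, (ha.injOn.mono Ico_subset_Ici_self).encard_image, ← Finset.coe_Ico,
    Set.encard_coe_eq_coe_finsetCard, Nat.card_Ico]
  exact_mod_cast Nat.sub_add_cancel hk

/-- The eigenvalues for a continuous positive weight are `a k = (p - 1) E(k ϖ)^p`, where `ϖ` is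
the half period and `E` the inverse of the terminal angle. The bounds `m ≤ q ≤ M` pinch them, and
for `q = 1` they give `a k = (k π_p)^p`. -/
theorem exists_eigenvalues (hp : 2 ≤ p) {m M : ℝ} (hq : ContinuousOn q (Icc 0 1)) (hm : 0 < m)
    (hmq : ∀ t ∈ Icc (0 : ℝ) 1, m ≤ q t) (hqM : ∀ t ∈ Icc (0 : ℝ) 1, q t ≤ M) (hm1 : m ≤ 1)
    (hM1 : 1 ≤ M) :
    ∃ a : ℕ → ℝ, ∀ k, 1 ≤ k → IsKthSmallest (weightedSpectrum p q) k (a k) ∧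
      (k * piP p / M) ^ p ≤ a k ∧ a k ≤ (k * piP p / m) ^ p := by
  have hp1 : 0 < p - 1 := by linarith
  have hM : 0 < M := by linarith
  have hq0 : ∀ t ∈ Icc (0 : ℝ) 1, 0 ≤ q t := fun t ht => hm.le.trans (hmq t ht)
  have hdata := angleData_abs_pSin_rpow hp hq hm hmq hqM hm1 hM1
  have hϖ := halfPeriod_pos hp
  obtain ⟨E, hE, hmono, hiff⟩ := hdata.exists_parameter
  have hkpos : ∀ k : ℕ, 1 ≤ k → 0 < k * halfPeriod p := fun k hk =>
    mul_pos (by exact_mod_cast hk) hϖ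
  set a : ℕ → ℝ := fun k => (p - 1) * E (k * halfPeriod p) ^ p with ha
  have hamono : StrictMonoOn a (Ici 1) := by
    intro j hj k hk hjk
    have h1 : E (j * halfPeriod p) < E (k * halfPeriod p) :=
      hmono (hkpos j hj) (hkpos k hk) (mul_lt_mul_of_pos_right (by exact_mod_cast hjk) hϖ)
    have h2 := Real.rpow_lt_rpow (hE _ (hkpos j hj)).1.le h1 (by linarith : 0 < p)
    exact mul_lt_mul_of_pos_left h2 hp1
  have hspec : weightedSpectrum p q = a '' Ici 1 := by
    ext l
    constructor
    · rintro ⟨v, hv⟩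
      have hl := hv.eigenvalue_pos hp hq hq0
      set μ : ℝ := (l / (p - 1)) ^ (1 / p) with hμ
      have hμ0 : 0 < μ := by positivity
      have hlμ : l = (p - 1) * μ ^ p := by
        rw [hμ, ← Real.rpow_mul (by positivity), one_div_mul_cancel (by linarith), Real.rpow_one]
        field_simp
      rw [hlμ] at hv
      obtain ⟨θ, k, hθ, hθ1⟩ := hv.exists_isAngle hp hq hq0 hqM hM1 hμ0
      have h1 := hdata.le_angle_one hμ0.le hθ
      have h2 : (0 : ℝ) < k := by
        rw [hθ1] at h1
        exact pos_of_mul_pos_left ((mul_pos hμ0 hm).trans_le h1) hϖ.le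
      have h3 : 0 < k := by exact_mod_cast h2
      lift k to ℕ using h3.le
      have hk : 1 ≤ k := by exact_mod_cast h3
      refine ⟨k, hk, ?_⟩
      rw [hlμ, (hiff μ hμ0 (k * halfPeriod p) (hkpos k hk) θ hθ).1 (by simpa using hθ1)]
    · rintro ⟨k, hk, rfl⟩
      have hE0 := (hE _ (hkpos k hk)).1
      obtain ⟨θ, hθ⟩ := hdata.exists_isAngle hE0.le
      exact isWeightedEigenfunction_of_isAngle hp hq hE0 hθ hk
        ((hiff _ hE0 _ (hkpos k hk) θ hθ).2 rfl)
  refine ⟨a, fun k hk => ⟨isKthSmallest_of_strictMonoOn hamono hspec hk, ?_⟩⟩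
  obtain ⟨h0, hlow, hupp⟩ := hE _ (hkpos k hk)
  have hform : ∀ c > 0, (k * piP p / c) ^ p = (p - 1) * (k * halfPeriod p / c) ^ p := by
    intro c hc
    have : k * piP p / c = (p - 1) ^ (1 / p) * (k * halfPeriod p / c) := by
      rw [piP_eq hp]; ring
    rw [this, Real.mul_rpow (by positivity) (div_pos (hkpos k hk) hc).le,
      ← Real.rpow_mul hp1.le, one_div_mul_cancel (by linarith), Real.rpow_one]
  rw [hform M hM, hform m hm]
  have := (hkpos k hk).le
  constructor
  · simp only [ha]; gcongr
  · simp only [ha]; gcongr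

end Weighted

/-! ### The radial problem -/

section RadialCalculus

variable {N : ℕ} {x : EuclideanSpace ℝ (Fin N)}

lemma hasFDerivAt_norm_of_ne_zero (hx : x ≠ 0) :
    HasFDerivAt (fun y : EuclideanSpace ℝ (Fin N) => ‖y‖) (‖x‖⁻¹ • innerSL ℝ x) x := by
  have hpos : 0 < ‖x‖ := norm_pos_iff.2 hx
  have h1 := (hasStrictFDerivAt_norm_sq x).hasFDerivAt.sqrt (by positivity)
  have h2 : (fun y : EuclideanSpace ℝ (Fin N) => √(‖y‖ ^ 2)) = fun y => ‖y‖ := by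
    funext y; exact Real.sqrt_sq (norm_nonneg y)
  rw [h2] at h1
  refine h1.congr_fderiv ?_
  rw [Real.sqrt_sq hpos.le]
  ext y
  simp
  field_simp

/-- The gradient of a radial function. -/
lemma hasGradientAt_comp_norm {U : ℝ → ℝ} {U' : ℝ} (hx : x ≠ 0) (hU : HasDerivAt U U' ‖x‖) :
    HasGradientAt (fun y : EuclideanSpace ℝ (Fin N) => U ‖y‖) ((U' / ‖x‖) • x) x := by
  rw [hasGradientAt_iff_hasFDerivAt]
  refine (hU.comp_hasFDerivAt x (hasFDerivAt_norm_of_ne_zero hx)).congr_fderiv ?_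
  ext y
  simp
  ring

lemma hasFDerivAt_comp_norm_smul {c : ℝ → ℝ} {c' : ℝ} (hx : x ≠ 0) (hc : HasDerivAt c c' ‖x‖) :
    HasFDerivAt (fun y : EuclideanSpace ℝ (Fin N) => c ‖y‖ • y)
      (c ‖x‖ • ContinuousLinearMap.id ℝ _ + (c' • ‖x‖⁻¹ • innerSL ℝ x).smulRight x) x :=
  (hc.comp_hasFDerivAt x (hasFDerivAt_norm_of_ne_zero hx)).smul (hasFDerivAt_id x)

/-- The divergence of a radial vector field `c(|x|) x`. -/
lemma divergence_comp_norm_smul {c : ℝ → ℝ} {c' : ℝ} (hx : x ≠ 0) (hc : HasDerivAt c c' ‖x‖)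
    {V : EuclideanSpace ℝ (Fin N) → EuclideanSpace ℝ (Fin N)}
    (hV : V =ᶠ[𝓝 x] fun y => c ‖y‖ • y) :
    DifferentiableAt ℝ V x ∧ divergence V x = N * c ‖x‖ + c' * ‖x‖ := by
  have h := (hasFDerivAt_comp_norm_smul hx hc).congr_of_eventuallyEq hV
  refine ⟨h.differentiableAt, ?_⟩
  have hpos : 0 < ‖x‖ := norm_pos_iff.2 hx
  have h2 : ∑ i, x i * x i = ‖x‖ ^ 2 := by
    rw [EuclideanSpace.real_norm_sq_eq]; simp [sq]
  rw [divergence, h.fderiv]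
  simp only [add_apply, smul_apply,
    ContinuousLinearMap.id_apply, ContinuousLinearMap.smulRight_apply, innerSL_apply_apply,
    EuclideanSpace.inner_single_right, PiLp.add_apply, PiLp.smul_apply, smul_eq_mul]
  simp [Finset.sum_add_distrib, mul_assoc, ← Finset.mul_sum, h2]
  left
  field_simp

end RadialCalculus

lemma abs_rpow_sub_two_mul (p x : ℝ) : |x| ^ (p - 2) * x = oddPow (p - 1) x := by
  rw [oddPow]; congr 2; ring

lemma pFlux_eq_of_hasGradientAt {N : ℕ} {p : ℝ} {u : EuclideanSpace ℝ (Fin N) → ℝ}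
    {x : EuclideanSpace ℝ (Fin N)} {d : ℝ} (hx : x ≠ 0)
    (h : HasGradientAt u ((d / ‖x‖) • x) x) : pFlux p u x = (oddPow (p - 1) d / ‖x‖) • x := by
  have hpos : 0 < ‖x‖ := norm_pos_iff.2 hx
  have hn : ‖(d / ‖x‖) • x‖ = |d| := by
    rw [norm_smul, norm_div, norm_norm, Real.norm_eq_abs, div_mul_cancel₀ _ hpos.ne']
  rw [pFlux, h.gradient, hn, smul_smul, ← abs_rpow_sub_two_mul]
  congr 1
  ring

/-- The change of variables `r = ρ t` between `[0, 1]` and `[R, R']`, with inverse `τ` and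
derivative `ρ'`. The condition `ρ'^(p-1) = K ρ^(N-1)` is what removes the first-order term of the
radial `p`-Laplacian: it makes the flux of `U ∘ ρ` a constant multiple of `r^(N-1) |U'|^(p-2) U'`,
and the transformed weight is `ρ'^p`. -/
structure RadialChange (N : ℕ) (p R R' : ℝ) (ρ ρ' τ : ℝ → ℝ) (K : ℝ) : Prop where
  pos : 0 < R
  lt : R < R'
  const_pos : 0 < K
  hasDerivAt : ∀ t ∈ Icc (0 : ℝ) 1, HasDerivAt ρ (ρ' t) t
  deriv_pos : ∀ t ∈ Icc (0 : ℝ) 1, 0 < ρ' t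
  deriv_rpow : ∀ t ∈ Icc (0 : ℝ) 1, ρ' t ^ (p - 1) = K * ρ t ^ (N - 1)
  zero : ρ 0 = R
  one : ρ 1 = R'
  hasDerivAt_inv : ∀ r ∈ Icc R R', HasDerivAt τ (ρ' (τ r))⁻¹ r
  inv_left : τ R = 0
  inv_right : τ R' = 1
  left_inv : ∀ t ∈ Icc (0 : ℝ) 1, τ (ρ t) = t
  right_inv : ∀ r ∈ Icc R R', ρ (τ r) = r
  map_mem : ∀ t ∈ Ioo (0 : ℝ) 1, ρ t ∈ Ioo R R'
  inv_mem : ∀ r ∈ Ioo R R', τ r ∈ Ioo (0 : ℝ) 1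

namespace RadialChange

variable {N : ℕ} {p R R' K l : ℝ} {ρ ρ' τ q : ℝ → ℝ}

lemma map_mem_Icc (h : RadialChange N p R R' ρ ρ' τ K) {t : ℝ} (ht : t ∈ Icc (0 : ℝ) 1) :
    ρ t ∈ Icc R R' := by
  rcases ht.1.eq_or_lt with rfl | h0
  · rw [h.zero]; exact left_mem_Icc.2 h.lt.le
  rcases ht.2.eq_or_lt with rfl | h1
  · rw [h.one]; exact right_mem_Icc.2 h.lt.le
  exact Ioo_subset_Icc_self (h.map_mem t ⟨h0, h1⟩)

lemma inv_mem_Icc (h : RadialChange N p R R' ρ ρ' τ K) {r : ℝ} (hr : r ∈ Icc R R') :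
    τ r ∈ Icc (0 : ℝ) 1 := by
  rcases hr.1.eq_or_lt with rfl | h0
  · rw [h.inv_left]; simp
  rcases hr.2.eq_or_lt with rfl | h1
  · rw [h.inv_right]; simp
  exact Ioo_subset_Icc_self (h.inv_mem r ⟨h0, h1⟩)

lemma hasDerivAt_pow (h : RadialChange N p R R' ρ ρ' τ K) (hN : 1 ≤ N) {t : ℝ}
    (ht : t ∈ Icc (0 : ℝ) 1) :
    HasDerivAt (fun t => ρ t ^ (N - 1)) ((N - 1) * ρ t ^ (N - 1) / ρ t * ρ' t) t := by
  have hρ : 0 < ρ t := h.pos.trans_le (h.map_mem_Icc ht).1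
  refine ((h.hasDerivAt t ht).pow (N - 1)).congr_deriv ?_
  obtain ⟨n, rfl⟩ : ∃ n, N = n + 1 := ⟨N - 1, by omega⟩
  rcases n with _ | n
  · simp
  · simp only [Nat.add_sub_cancel]
    push_cast
    rw [pow_succ (ρ t) n]
    field_simp
    ring

/-- A radial eigenfunction restricted to a ray and composed with `ρ` is an eigenfunction of the
weighted problem. -/
theorem radialSpectrum_subset (h : RadialChange N p R R' ρ ρ' τ K) (hN : 1 ≤ N) (hp : 2 ≤ p)
    (hq : ∀ t ∈ Ioo (0 : ℝ) 1, q t = ρ' t ^ p) :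
    radialSpectrum N p R R' ⊆ weightedSpectrum p q := by
  rintro l ⟨u, hu⟩
  have : NeZero N := ⟨by omega⟩
  set e : EuclideanSpace ℝ (Fin N) := EuclideanSpace.single 0 1 with he
  have he1 : ‖e‖ = 1 := by simp [he]
  have hnorm : ∀ r, 0 ≤ r → ‖r • e‖ = r := fun r hr => by
    rw [norm_smul, he1, mul_one, Real.norm_of_nonneg hr]
  set U : ℝ → ℝ := fun r => u (r • e) with hU
  have hpos : ∀ r ∈ Ioo R R', 0 < r := fun r hr => h.pos.trans hr.1
  have hemem : ∀ r ∈ Ioo R R', R < ‖r • e‖ ∧ ‖r • e‖ < R' := fun r hr => by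
    rw [hnorm r (hpos r hr).le]; exact hr
  have hline : ∀ r : ℝ, HasDerivAt (fun r : ℝ => r • e) e r := fun r => by
    simpa using (hasDerivAt_id r).smul_const e
  have hUd : ∀ r ∈ Ioo R R', HasDerivAt U (deriv U r) r := fun r hr =>
    ((hu.differentiableAt _ (hemem r hr).1 (hemem r hr).2).comp r
      (hline r).differentiableAt).hasDerivAt
  have hnhds : ∀ x : EuclideanSpace ℝ (Fin N), R < ‖x‖ → ‖x‖ < R' →
      ∀ᶠ y in 𝓝 x, R < ‖y‖ ∧ ‖y‖ < R' := fun x h1 h2 =>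
    (continuous_norm.continuousAt.eventually (lt_mem_nhds h1)).and
      (continuous_norm.continuousAt.eventually (gt_mem_nhds h2))
  have hne : ∀ x : EuclideanSpace ℝ (Fin N), R < ‖x‖ → x ≠ 0 := fun x hx h0 => by
    rw [h0, norm_zero] at hx; exact lt_asymm hx h.pos
  have huU : ∀ x : EuclideanSpace ℝ (Fin N), R < ‖x‖ → ‖x‖ < R' → u x = U ‖x‖ := fun x h1 h2 =>
    hu.radial x _ h1 h2 (hnorm _ (norm_nonneg x)).symm
  have hgrad : ∀ x : EuclideanSpace ℝ (Fin N), R < ‖x‖ → ‖x‖ < R' →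
      pFlux p u x = (oddPow (p - 1) (deriv U ‖x‖) / ‖x‖) • x := fun x h1 h2 => by
    refine pFlux_eq_of_hasGradientAt (hne x h1) ?_
    have := hasGradientAt_comp_norm (hne x h1) (hUd ‖x‖ ⟨h1, h2⟩)
    rw [hasGradientAt_iff_hasFDerivAt] at this ⊢
    exact this.congr_of_eventuallyEq ((hnhds x h1 h2).mono fun y hy => huU y hy.1 hy.2)
  set H : ℝ → ℝ := fun r => oddPow (p - 1) (deriv U r) with hH
  have hHd : ∀ r ∈ Ioo R R', HasDerivAt H (deriv H r) r := by
    intro r hr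
    -- `H` is the radial component of the flux, which is differentiable by assumption.
    have hf : DifferentiableAt ℝ (pFlux p u ∘ fun s : ℝ => s • e) r :=
      (hu.differentiableAt_flux _ (hemem r hr).1 (hemem r hr).2).comp r (hline r).differentiableAt
    have hd : DifferentiableAt ℝ (fun s : ℝ => inner ℝ e (pFlux p u (s • e))) r :=
      (differentiableAt_const e).inner ℝ hf
    refine (hd.congr_of_eventuallyEq ?_).hasDerivAt
    filter_upwards [Ioo_mem_nhds hr.1 hr.2] with s hs
    rw [hgrad _ (hemem s hs).1 (hemem s hs).2, hnorm s (hpos s hs).le, smul_smul,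
      inner_smul_right, real_inner_self_eq_norm_sq, he1, div_mul_cancel₀ _ (hpos s hs).ne']
    simp [hH]
  -- The radial form of the equation, `H' + (N - 1) H / r = -l |U|^(p-2) U`.
  have hODE : ∀ r ∈ Ioo R R',
      deriv H r = -(l * oddPow (p - 1) (U r)) - (N - 1) * H r / r := by
    intro r hr
    have hr0 := hpos r hr
    have hmem := hemem r hr
    have hn := hnorm r hr0.le
    have hc : HasDerivAt (fun s => H s / s) ((deriv H r * r - H r * 1) / r ^ 2) ‖r • e‖ := by
      rw [hn]; exact (hHd r hr).div (hasDerivAt_id r) hr0.ne'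
    have h1 := (divergence_comp_norm_smul (hne _ hmem.1) hc
      ((hnhds _ hmem.1 hmem.2).mono fun y hy => hgrad y hy.1 hy.2)).2
    have h2 := hu.equation _ hmem.1 hmem.2
    rw [pLaplacian, h1, hn, abs_rpow_sub_two_mul, huU _ hmem.1 hmem.2, hn] at h2
    field_simp at h2 ⊢
    linarith
  have hρp : ∀ t ∈ Icc (0 : ℝ) 1, ρ' t ^ p = ρ' t ^ (p - 1) * ρ' t := fun t ht => by
    rw [← Real.rpow_add_one (h.deriv_pos t ht).ne', sub_add_cancel]
  have hvd : ∀ t ∈ Ioo (0 : ℝ) 1, HasDerivAt (fun t => U (ρ t)) (deriv U (ρ t) * ρ' t) t :=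
    fun t ht => (hUd _ (h.map_mem t ht)).comp t (h.hasDerivAt t (Ioo_subset_Icc_self ht))
  refine ⟨fun t => U (ρ t), ?_, fun t ht => (hvd t ht).differentiableAt, fun t ht => ?_, ?_, ?_, ?_⟩
  · refine hu.continuousOn.comp (f := fun t => ρ t • e)
      (fun t ht => ((h.hasDerivAt t ht).continuousAt.smul continuousAt_const).continuousWithinAt)
      fun t ht => ?_
    have := h.map_mem_Icc ht
    rw [mem_ofPred_eq, hnorm _ (h.pos.le.trans this.1)]
    exact this
  · have ht' := Ioo_subset_Icc_self ht
    have hm := h.map_mem t ht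
    have h1 : HasDerivAt (fun s => K * (ρ s ^ (N - 1) * H (ρ s)))
        (-(l * q t * (|U (ρ t)| ^ (p - 2) * U (ρ t)))) t := by
      have h2 := (((h.hasDerivAt_pow hN ht').mul
        ((hHd _ hm).comp t (h.hasDerivAt t ht'))).const_mul K)
      refine h2.congr_deriv ?_
      rw [abs_rpow_sub_two_mul, hq t ht, hρp t ht', h.deriv_rpow t ht', hODE _ hm]
      simp only [Function.comp]
      have := hpos _ hm
      field_simp
      ring
    refine h1.congr_of_eventuallyEq ?_
    filter_upwards [Ioo_mem_nhds ht.1 ht.2] with s hs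
    rw [(hvd s hs).deriv, abs_rpow_sub_two_mul, mul_comm (deriv U (ρ s)),
      oddPow_pos_mul (by linarith) (h.deriv_pos s (Ioo_subset_Icc_self hs)).le,
      h.deriv_rpow s (Ioo_subset_Icc_self hs), mul_assoc]
  · exact hu.boundary _ (Or.inl (by rw [h.zero, hnorm _ h.pos.le]))
  · exact hu.boundary _ (Or.inr (by rw [h.one, hnorm _ (h.pos.trans h.lt).le]))
  · obtain ⟨x, h1, h2, h3⟩ := hu.nontrivial
    refine ⟨τ ‖x‖, h.inv_mem _ ⟨h1, h2⟩, ?_⟩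
    rwa [h.right_inv _ ⟨h1.le, h2.le⟩, ← huU x h1 h2]

/-- An eigenfunction `v` of the weighted problem gives the radial eigenfunction `x ↦ v (τ |x|)`. -/
theorem weightedSpectrum_subset (h : RadialChange N p R R' ρ ρ' τ K) (hN : 1 ≤ N) (hp : 2 ≤ p)
    (hq : ∀ t ∈ Ioo (0 : ℝ) 1, q t = ρ' t ^ p) :
    weightedSpectrum p q ⊆ radialSpectrum N p R R' := by
  rintro l ⟨v, hv⟩
  have : NeZero N := ⟨by omega⟩
  have hpos : ∀ r ∈ Ioo R R', 0 < r := fun r hr => h.pos.trans hr.1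
  have hne : ∀ x : EuclideanSpace ℝ (Fin N), R < ‖x‖ → x ≠ 0 := fun x hx h0 => by
    rw [h0, norm_zero] at hx; exact lt_asymm hx h.pos
  have hnhds : ∀ x : EuclideanSpace ℝ (Fin N), R < ‖x‖ → ‖x‖ < R' →
      ∀ᶠ y in 𝓝 x, R < ‖y‖ ∧ ‖y‖ < R' := fun x h1 h2 =>
    (continuous_norm.continuousAt.eventually (lt_mem_nhds h1)).and
      (continuous_norm.continuousAt.eventually (gt_mem_nhds h2))
  have hUd : ∀ r ∈ Ioo R R', HasDerivAt (fun r => v (τ r)) (deriv v (τ r) * (ρ' (τ r))⁻¹) r :=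
    fun r hr => (hv.differentiableAt _ (h.inv_mem r hr)).hasDerivAt.comp r
      (h.hasDerivAt_inv r (Ioo_subset_Icc_self hr))
  set u : EuclideanSpace ℝ (Fin N) → ℝ := fun x => v (τ ‖x‖) with hu
  have hgrad : ∀ x : EuclideanSpace ℝ (Fin N), R < ‖x‖ → ‖x‖ < R' →
      HasGradientAt u ((deriv v (τ ‖x‖) * (ρ' (τ ‖x‖))⁻¹ / ‖x‖) • x) x := fun x h1 h2 =>
    hasGradientAt_comp_norm (hne x h1) (hUd _ ⟨h1, h2⟩)
  set G : ℝ → ℝ := fun t => |deriv v t| ^ (p - 2) * deriv v t with hG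
  set c : ℝ → ℝ := fun r => G (τ r) / (K * r ^ N) with hc
  have hflux : ∀ x : EuclideanSpace ℝ (Fin N), R < ‖x‖ → ‖x‖ < R' →
      pFlux p u x = c ‖x‖ • x := fun x h1 h2 => by
    have hm := h.inv_mem_Icc (r := ‖x‖) ⟨h1.le, h2.le⟩
    have hd := h.deriv_pos _ hm
    have hx0 := hpos _ ⟨h1, h2⟩
    rw [pFlux_eq_of_hasGradientAt (hne x h1) (hgrad x h1 h2), mul_comm (deriv v _),
      oddPow_pos_mul (by linarith) (inv_nonneg.2 hd.le), Real.inv_rpow hd.le, h.deriv_rpow _ hm,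
      h.right_inv _ ⟨h1.le, h2.le⟩]
    congr 1
    simp only [hc, hG, abs_rpow_sub_two_mul]
    have h3 : ‖x‖ ^ N = ‖x‖ ^ (N - 1) * ‖x‖ := by
      rw [← pow_succ, Nat.sub_add_cancel hN]
    rw [h3]
    have := h.const_pos
    field_simp
  have hcd : ∀ r ∈ Ioo R R', HasDerivAt c
      (-(l * oddPow (p - 1) (v (τ r))) / r - N * c r / r) r := by
    intro r hr
    have hm := h.inv_mem r hr
    have hm' := Ioo_subset_Icc_self hm
    have hr0 := hpos r hr
    have hd := h.deriv_pos _ hm'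
    have hK := h.const_pos
    have h1 := ((hv.equation _ hm).comp r (h.hasDerivAt_inv r (Ioo_subset_Icc_self hr))).div
      (((hasDerivAt_id r).pow N).const_mul K) (by simp only [Pi.pow_apply, id]; positivity)
    refine h1.congr_deriv ?_
    have e1 : ρ' (τ r) ^ p = K * r ^ (N - 1) * ρ' (τ r) := by
      have := h.deriv_rpow _ hm'
      rw [h.right_inv r (Ioo_subset_Icc_self hr)] at this
      rw [← this, ← Real.rpow_add_one hd.ne', sub_add_cancel]
    have e2 : r ^ N = r ^ (N - 1) * r := by rw [← pow_succ, Nat.sub_add_cancel hN]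
    simp only [Function.comp, Pi.pow_apply, id, hc, mul_one]
    rw [abs_rpow_sub_two_mul, hq _ hm, e1, e2]
    simp only [hG]
    field_simp
  have hdiv : ∀ x : EuclideanSpace ℝ (Fin N), R < ‖x‖ → ‖x‖ < R' → _ := fun x h1 h2 =>
    divergence_comp_norm_smul (hne x h1) (hcd _ ⟨h1, h2⟩)
      ((hnhds x h1 h2).mono fun y hy => hflux y hy.1 hy.2)
  refine ⟨u, ?_, fun x h1 h2 => (hgrad x h1 h2).differentiableAt, fun x h1 h2 => (hdiv x h1 h2).1,
    fun x h1 h2 => ?_, ?_, fun x y _ _ hxy => by simp only [hu, hxy], ?_⟩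
  · refine hv.continuousOn.comp (f := fun x => τ ‖x‖) (fun x hx => ?_) fun x hx => h.inv_mem_Icc hx
    exact ((h.hasDerivAt_inv _ hx).continuousAt.comp (f := fun x : EuclideanSpace ℝ (Fin N) => ‖x‖)
      continuous_norm.continuousAt).continuousWithinAt
  · rw [pLaplacian, (hdiv x h1 h2).2, abs_rpow_sub_two_mul]
    have := hpos _ ⟨h1, h2⟩
    field_simp
    ring
  · rintro x (hx | hx)
    · simp only [hu, hx, h.inv_left, hv.left]
    · simp only [hu, hx, h.inv_right, hv.right]
  · obtain ⟨t, ht, hne⟩ := hv.nontrivial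
    have hm := h.map_mem t ht
    have hn : ‖ρ t • (EuclideanSpace.single 0 1 : EuclideanSpace ℝ (Fin N))‖ = ρ t := by
      rw [norm_smul, Real.norm_of_nonneg (hpos _ hm).le]; simp
    refine ⟨ρ t • EuclideanSpace.single 0 1, ?_, ?_, ?_⟩
    · rw [hn]; exact hm.1
    · rw [hn]; exact hm.2
    · simp only [hu, hn, h.left_inv t (Ioo_subset_Icc_self ht)]
      exact hne

theorem radialSpectrum_eq (h : RadialChange N p R R' ρ ρ' τ K) (hN : 1 ≤ N) (hp : 2 ≤ p)
    (hq : ∀ t ∈ Ioo (0 : ℝ) 1, q t = ρ' t ^ p) :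
    radialSpectrum N p R R' = weightedSpectrum p q :=
  (h.radialSpectrum_subset hN hp hq).antisymm (h.weightedSpectrum_subset hN hp hq)

end RadialChange

/-! ### The limit of the eigenvalues -/

/-- The conclusion for any `p ≥ 2` and `N` for which the spectra agree and the weight lies between
bounds that tend to `1`. -/
theorem eigenvalue_limits {N : ℕ} {p : ℝ} (hp : 2 ≤ p) {m M : ℝ → ℝ}
    (hcont : ∀ R > 0, ContinuousOn (weight N p R (R + 1)) (Icc 0 1))
    (hpos : ∀ R > 0, 0 < m R)
    (hm : ∀ R > 0, ∀ t ∈ Icc (0 : ℝ) 1, m R ≤ weight N p R (R + 1) t)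
    (hM : ∀ R > 0, ∀ t ∈ Icc (0 : ℝ) 1, weight N p R (R + 1) t ≤ M R)
    (hspec : ∀ R > 0, radialSpectrum N p R (R + 1) = weightedSpectrum p (weight N p R (R + 1)))
    (hm1 : Tendsto m atTop (𝓝 1)) (hM1 : Tendsto M atTop (𝓝 1)) :
    Tendsto (fun R : ℝ => qPlus N p R (R + 1)) atTop (𝓝 1) ∧
    Tendsto (fun R : ℝ => qMinus N p R (R + 1)) atTop (𝓝 1) ∧
    ∃ lam : ℕ → ℝ → ℝ,
      (∀ k : ℕ, 1 ≤ k → ∀ R : ℝ, 0 < R →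
        IsKthSmallest (radialSpectrum N p R (R + 1)) k (lam k R) ∧
        IsKthSmallest (weightedSpectrum p (weight N p R (R + 1))) k (lam k R)) ∧
      ∀ k : ℕ, 1 ≤ k →
        Tendsto (lam k) atTop (𝓝 ((k * piP p) ^ p)) ∧
        IsKthSmallest (weightedSpectrum p (fun _ => 1)) k ((k * piP p) ^ p) := by
  have hmin : Tendsto (fun R => min 1 (m R)) atTop (𝓝 1) := by
    simpa using (tendsto_const_nhds (x := (1 : ℝ))).min hm1
  have hmax : Tendsto (fun R => max 1 (M R)) atTop (𝓝 1) := by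
    simpa using (tendsto_const_nhds (x := (1 : ℝ))).max hM1
  refine ⟨?_, ?_, ?_⟩
  · refine tendsto_of_tendsto_of_tendsto_of_le_of_le' tendsto_const_nhds hmax ?_ ?_
    all_goals
      filter_upwards [eventually_gt_atTop 0] with R hR
      have hint : IntervalIntegrable (fun t => max 1 (weight N p R (R + 1) t))
          MeasureTheory.volume 0 1 := by
        refine ContinuousOn.intervalIntegrable ?_
        rw [uIcc_of_le zero_le_one]
        exact continuousOn_const.sup (hcont R hR)
    · calc (1 : ℝ) = ∫ _ in (0 : ℝ)..1, (1 : ℝ) := by simp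
        _ ≤ _ := intervalIntegral.integral_mono_on zero_le_one (by simp) hint
          fun t _ => le_max_left _ _
    · calc qPlus N p R (R + 1) ≤ ∫ _ in (0 : ℝ)..1, max 1 (M R) :=
          intervalIntegral.integral_mono_on zero_le_one hint (by simp)
            fun t ht => max_le_max le_rfl (hM R hR t ht)
        _ = _ := by simp
  · refine tendsto_of_tendsto_of_tendsto_of_le_of_le' hmin tendsto_const_nhds ?_ ?_
    all_goals
      filter_upwards [eventually_gt_atTop 0] with R hR
      have hint : IntervalIntegrable (fun t => min 1 (weight N p R (R + 1) t))
          MeasureTheory.volume 0 1 := by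
        refine ContinuousOn.intervalIntegrable ?_
        rw [uIcc_of_le zero_le_one]
        exact continuousOn_const.inf (hcont R hR)
    · calc min 1 (m R) = ∫ _ in (0 : ℝ)..1, min 1 (m R) := by simp
        _ ≤ _ := intervalIntegral.integral_mono_on zero_le_one (by simp) hint
          fun t ht => min_le_min le_rfl (hm R hR t ht)
    · calc qMinus N p R (R + 1) ≤ ∫ _ in (0 : ℝ)..1, (1 : ℝ) :=
          intervalIntegral.integral_mono_on zero_le_one hint (by simp)
            fun t _ => min_le_left _ _
        _ = _ := by simp
  · choose! a ha using fun R (hR : 0 < R) => exists_eigenvalues hp (hcont R hR)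
      (lt_min one_pos (hpos R hR)) (fun t ht => (min_le_right _ _).trans (hm R hR t ht))
      (fun t ht => (hM R hR t ht).trans (le_max_right 1 _)) (min_le_left _ _) (le_max_left _ _)
    refine ⟨fun k R => a R k, fun k hk R hR => ⟨?_, (ha R hR k hk).1⟩, fun k hk => ⟨?_, ?_⟩⟩
    · rw [hspec R hR]; exact (ha R hR k hk).1
    · have hlim : ∀ f : ℝ → ℝ, Tendsto f atTop (𝓝 1) →
          Tendsto (fun R => (k * piP p / f R) ^ p) atTop (𝓝 ((k * piP p) ^ p)) := fun f hf => by
        have := (tendsto_const_nhds (x := k * piP p)).div hf one_ne_zero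
        rw [div_one] at this
        exact this.rpow_const (Or.inr (by linarith))
      refine tendsto_of_tendsto_of_tendsto_of_le_of_le' (hlim _ hmax) (hlim _ hmin) ?_ ?_
      · filter_upwards [eventually_gt_atTop 0] with R hR using (ha R hR k hk).2.1
      · filter_upwards [eventually_gt_atTop 0] with R hR using (ha R hR k hk).2.2
    · obtain ⟨b, hb⟩ := exists_eigenvalues (q := fun _ => 1) hp continuousOn_const one_pos
        (fun _ _ => le_rfl) (fun _ _ => le_rfl) le_rfl le_rfl
      obtain ⟨h1, h2, h3⟩ := hb k hk
      rw [div_one] at h2 h3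
      rwa [← le_antisymm h3 h2]

/-! ### The change of variables for `p = N` -/

section Conformal

variable {N : ℕ} {R R' : ℝ}

/-- For `p = N` the radius is exponential in `t`, so that `ρ'` is proportional to `ρ`. -/
lemma radialChange_log (hN : 2 ≤ N) (hR : 0 < R) (hRR' : R < R') :
    RadialChange N N R R' (fun t => R * (R' / R) ^ t)
      (fun t => R * (R' / R) ^ t * Real.log (R' / R)) (fun r => Real.logb (R' / R) (r / R))
      (Real.log (R' / R) ^ (N - 1)) := by
  have hx : 1 < R' / R := (one_lt_div hR).2 hRR'
  have hx0 : 0 < R' / R := one_pos.trans hx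
  have hL : 0 < Real.log (R' / R) := Real.log_pos hx
  have hRne : R ≠ 0 := hR.ne'
  have hright : ∀ r ∈ Icc R R', R * (R' / R) ^ Real.logb (R' / R) (r / R) = r := fun r hr => by
    rw [Real.rpow_logb hx0 hx.ne' (div_pos (hR.trans_le hr.1) hR)]
    field_simp
  exact
    { pos := hR
      lt := hRR'
      const_pos := by positivity
      hasDerivAt := fun t _ => by
        have := ((Real.hasStrictDerivAt_const_rpow hx0 t).hasDerivAt).const_mul R
        rwa [← mul_assoc] at this
      deriv_pos := fun t _ => by positivity
      deriv_rpow := fun t _ => by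
        have : (N : ℝ) - 1 = ((N - 1 : ℕ) : ℝ) := by rw [Nat.cast_sub (by omega)]; simp
        rw [this, Real.rpow_natCast, mul_pow, mul_comm]
      zero := by simp
      one := by rw [Real.rpow_one]; field_simp
      hasDerivAt_inv := fun r hr => by
        have hr0 : 0 < r := hR.trans_le hr.1
        rw [hright r hr]
        have h1 := (((hasDerivAt_id r).div_const R).log (by simp only [id]; positivity)).div_const
          (Real.log (R' / R))
        refine h1.congr_deriv ?_
        simp only [id]
        field_simp
      inv_left := by rw [div_self hRne, Real.logb_one]
      inv_right := Real.logb_self_eq_one hx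
      left_inv := fun t _ => by
        rw [mul_div_cancel_left₀ _ hRne, Real.logb_rpow hx0 hx.ne']
      right_inv := hright
      map_mem := fun t ht => by
        constructor
        · have := Real.one_lt_rpow hx ht.1
          nlinarith
        · have := Real.rpow_lt_rpow_of_exponent_lt hx ht.2
          rw [Real.rpow_one, lt_div_iff₀ hR] at this
          linarith
      inv_mem := fun r hr => by
        have hr0 : 0 < r := hR.trans hr.1
        refine ⟨Real.logb_pos hx ((one_lt_div hR).2 hr.1), ?_⟩
        rw [← Real.logb_self_eq_one hx]
        exact Real.logb_lt_logb hx (by positivity) (by gcongr; exact hr.2) }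

lemma weight_self (N : ℕ) (R R' t : ℝ) :
    weight N N R R' t = (R * (R' / R) ^ t * Real.log (R' / R)) ^ (N : ℝ) := by
  simp [weight]

lemma tendsto_mul_log_succ_div :
    Tendsto (fun R : ℝ => R * Real.log ((R + 1) / R)) atTop (𝓝 1) := by
  refine (Real.tendsto_mul_log_one_add_div_atTop 1).congr' ?_
  filter_upwards [eventually_gt_atTop 0] with R hR
  congr 2
  field_simp

lemma tendsto_succ_div : Tendsto (fun R : ℝ => (R + 1) / R) atTop (𝓝 1) := by
  have h : Tendsto (fun R : ℝ => 1 + R⁻¹) atTop (𝓝 (1 + 0)) :=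
    tendsto_inv_atTop_zero.const_add 1
  rw [add_zero] at h
  refine h.congr' ?_
  filter_upwards [eventually_gt_atTop 0] with R hR
  field_simp

end Conformal

/-! ### The change of variables for `p = 2` in dimension `n + 2` -/

section Laplacian

variable {n : ℕ} {R R' : ℝ}

lemma coeffA_two (n : ℕ) (R R' : ℝ) :
    coeffA (n + 2) 2 R R' = (R * R') ^ n / (R' ^ n - R ^ n) := by
  have h : (((n + 2 : ℕ) : ℝ) - 2) / (2 - 1) = n := by push_cast; ring
  rw [coeffA, h]
  simp only [Real.rpow_natCast]

lemma coeffB_two (n : ℕ) (R R' : ℝ) :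
    coeffB (n + 2) 2 R R' = R' ^ n / (R' ^ n - R ^ n) := by
  have h : (((n + 2 : ℕ) : ℝ) - 2) / (2 - 1) = n := by push_cast; ring
  rw [coeffB, h]
  simp only [Real.rpow_natCast]

lemma coeffA_two_pos (hn : 1 ≤ n) (hR : 0 < R) (hRR' : R < R') : 0 < coeffA (n + 2) 2 R R' := by
  have hR' := hR.trans hRR'
  have : R ^ n < R' ^ n := by gcongr
  rw [coeffA_two]
  have := sub_pos.2 this
  positivity

lemma coeffB_two_eq (hn : 1 ≤ n) (hR : 0 < R) (hRR' : R < R') :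
    coeffB (n + 2) 2 R R' = coeffA (n + 2) 2 R R' / R ^ n ∧
      coeffB (n + 2) 2 R R' = 1 + coeffA (n + 2) 2 R R' / R' ^ n := by
  have hR' := hR.trans hRR'
  have : R ^ n < R' ^ n := by gcongr
  have := sub_pos.2 this
  rw [coeffA_two, coeffB_two, mul_pow]
  constructor
  · field_simp
  · field_simp
    ring

/-- The radius as a function of `t` for `p = 2` in dimension `n + 2`: the solution of
`t = B - A / r ^ n`. -/
def powRadius (n : ℕ) (R R' t : ℝ) : ℝ :=
  (coeffA (n + 2) 2 R R' / (coeffB (n + 2) 2 R R' - t)) ^ (1 / (n : ℝ))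

lemma coeffB_two_sub_pos (hn : 1 ≤ n) (hR : 0 < R) (hRR' : R < R') {t : ℝ} (ht : t ≤ 1) :
    0 < coeffB (n + 2) 2 R R' - t := by
  have hR' := hR.trans hRR'
  rw [(coeffB_two_eq hn hR hRR').2]
  have : 0 < coeffA (n + 2) 2 R R' / R' ^ n := div_pos (coeffA_two_pos hn hR hRR') (by positivity)
  linarith

lemma powRadius_pow (hn : 1 ≤ n) (hR : 0 < R) (hRR' : R < R') {t : ℝ} (ht : t ≤ 1) :
    powRadius n R R' t ^ n = coeffA (n + 2) 2 R R' / (coeffB (n + 2) 2 R R' - t) := by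
  have hA := coeffA_two_pos hn hR hRR'
  have hB := coeffB_two_sub_pos hn hR hRR' ht
  have hn0 : (n : ℝ) ≠ 0 := by positivity
  rw [powRadius, ← Real.rpow_natCast, ← Real.rpow_mul (by positivity), one_div_mul_cancel hn0,
    Real.rpow_one]

lemma powRadius_pos (hn : 1 ≤ n) (hR : 0 < R) (hRR' : R < R') {t : ℝ} (ht : t ≤ 1) :
    0 < powRadius n R R' t :=
  Real.rpow_pos_of_pos (div_pos (coeffA_two_pos hn hR hRR') (coeffB_two_sub_pos hn hR hRR' ht)) _

lemma powRadius_eq_of_pow_eq (hn : 1 ≤ n) (hR : 0 < R) (hRR' : R < R') {t r : ℝ} (ht : t ≤ 1)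
    (hr : 0 ≤ r) (h : coeffA (n + 2) 2 R R' / (coeffB (n + 2) 2 R R' - t) = r ^ n) :
    powRadius n R R' t = r := by
  refine (pow_left_inj₀ (n := n) (powRadius_pos hn hR hRR' ht).le hr (by omega)).1 ?_
  rw [powRadius_pow hn hR hRR' ht, h]

lemma hasDerivAt_powRadius (hn : 1 ≤ n) (hR : 0 < R) (hRR' : R < R') {t : ℝ} (ht : t ≤ 1) :
    HasDerivAt (powRadius n R R')
      (powRadius n R R' t ^ (n + 1) / (n * coeffA (n + 2) 2 R R')) t := by
  have hA := coeffA_two_pos hn hR hRR'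
  have hB := coeffB_two_sub_pos hn hR hRR' ht
  have hn0 : (n : ℝ) ≠ 0 := by positivity
  have h1 := ((hasDerivAt_const t (coeffA (n + 2) 2 R R')).div
    ((hasDerivAt_id t).const_sub (coeffB (n + 2) 2 R R')) hB.ne').rpow_const (p := 1 / (n : ℝ))
    (Or.inl (div_pos hA hB).ne')
  refine h1.congr_deriv ?_
  rw [pow_succ (powRadius n R R' t), powRadius_pow hn hR hRR' ht, powRadius, Real.rpow_sub_one]
  · simp only [Pi.div_apply, id]
    field_simp
    ring
  · simp only [Pi.div_apply, id]
    positivity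

/-- For `p = 2` in dimension `n + 2` one has `ρ' = ρ^(n+1) / (n A)`. -/
lemma radialChange_pow (hn : 1 ≤ n) (hR : 0 < R) (hRR' : R < R') :
    RadialChange (n + 2) 2 R R' (powRadius n R R')
      (fun t => powRadius n R R' t ^ (n + 1) / (n * coeffA (n + 2) 2 R R'))
      (fun r => coeffB (n + 2) 2 R R' - coeffA (n + 2) 2 R R' / r ^ n)
      (1 / (n * coeffA (n + 2) 2 R R')) := by
  have hA := coeffA_two_pos hn hR hRR'
  have hn0 : (0 : ℝ) < n := by positivity
  have hnn : n ≠ 0 := by omega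
  have hR' := hR.trans hRR'
  obtain ⟨hB1, hB2⟩ := coeffB_two_eq hn hR hRR'
  set A := coeffA (n + 2) 2 R R' with hAdef
  set B := coeffB (n + 2) 2 R R' with hBdef
  have hτ : ∀ r, R ≤ r → r ≤ R' → B - A / r ^ n ≤ 1 := fun r h1 h2 => by
    have : A / R' ^ n ≤ A / r ^ n := by
      have : 0 < r := hR.trans_le h1
      gcongr
    linarith
  have hright : ∀ r ∈ Icc R R', powRadius n R R' (B - A / r ^ n) = r := fun r hr => by
    have hr0 : 0 < r := hR.trans_le hr.1
    refine powRadius_eq_of_pow_eq hn hR hRR' (hτ r hr.1 hr.2) hr0.le ?_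
    rw [← hAdef, ← hBdef, sub_sub_cancel]
    field_simp
  exact
    { pos := hR
      lt := hRR'
      const_pos := by positivity
      hasDerivAt := fun t ht => hasDerivAt_powRadius hn hR hRR' ht.2
      deriv_pos := fun t ht => by
        have := powRadius_pos hn hR hRR' ht.2
        positivity
      deriv_rpow := fun t _ => by
        rw [show (2 : ℝ) - 1 = 1 by norm_num, Real.rpow_one]
        show _ = _ * powRadius n R R' t ^ (n + 1)
        ring
      zero := powRadius_eq_of_pow_eq hn hR hRR' zero_le_one hR.le (by
        rw [← hAdef, ← hBdef, sub_zero, hB1]; field_simp)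
      one := powRadius_eq_of_pow_eq hn hR hRR' le_rfl hR'.le (by
        rw [← hAdef, ← hBdef, hB2, add_sub_cancel_left]; field_simp)
      hasDerivAt_inv := fun r hr => by
        have hr0 : 0 < r := hR.trans_le hr.1
        rw [hright r hr]
        have h1 := ((hasDerivAt_const r A).div (hasDerivAt_pow n r) (by positivity)).const_sub B
        refine h1.congr_deriv ?_
        obtain ⟨k, rfl⟩ : ∃ k, n = k + 1 := ⟨n - 1, by omega⟩
        simp only [Nat.add_sub_cancel]
        field_simp
        ring
      inv_left := by rw [← hB1, sub_self]
      inv_right := by rw [hB2, add_sub_cancel_right]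
      left_inv := fun t ht => by
        have := coeffB_two_sub_pos hn hR hRR' ht.2
        rw [powRadius_pow hn hR hRR' ht.2, ← hAdef, ← hBdef]
        rw [← hBdef] at this
        field_simp
        ring
      right_inv := hright
      map_mem := fun t ht => by
        have h0 := powRadius_pos hn hR hRR' ht.2.le
        have hpow := powRadius_pow hn hR hRR' ht.2.le
        have hBt := coeffB_two_sub_pos hn hR hRR' ht.2.le
        rw [← hBdef] at hBt
        rw [← hAdef, ← hBdef] at hpow
        constructor
        · refine lt_of_pow_lt_pow_left₀ n h0.le ?_
          rw [hpow, lt_div_iff₀ hBt, mul_comm, ← lt_div_iff₀ (by positivity), ← hB1]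
          linarith [ht.1]
        · refine lt_of_pow_lt_pow_left₀ n hR'.le ?_
          rw [hpow, div_lt_iff₀ hBt, mul_comm, ← div_lt_iff₀ (by positivity)]
          linarith [ht.2]
      inv_mem := fun r hr => by
        have hr0 : 0 < r := hR.trans hr.1
        have h1 : A / r ^ n < A / R ^ n := by gcongr; exact hr.1
        have h2 : A / R' ^ n < A / r ^ n := by gcongr; exact hr.2
        constructor <;> linarith }

lemma weight_two (hn : 1 ≤ n) (hR : 0 < R) (hRR' : R < R') {t : ℝ} (ht : t ≤ 1) :
    weight (n + 2) 2 R R' t =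
      (powRadius n R R' t ^ (n + 1) / (n * coeffA (n + 2) 2 R R')) ^ (2 : ℝ) := by
  have hA := coeffA_two_pos hn hR hRR'
  have hB := coeffB_two_sub_pos hn hR hRR' ht
  have hn0 : (0 : ℝ) < n := by positivity
  have hne : ¬ (2 : ℝ) = ((n + 2 : ℕ) : ℝ) := by push_cast; linarith
  have hN : ((n + 2 : ℕ) : ℝ) - 2 = n := by push_cast; ring
  rw [weight, if_neg hne, pow_succ (powRadius n R R' t), powRadius_pow hn hR hRR' ht,
    powRadius, Real.rpow_two,
    Real.rpow_two, Real.div_rpow hA.le hB.le]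
  have e1 : (2 - 1) * 2 / (((n + 2 : ℕ) : ℝ) - 2) = 1 / (n : ℝ) * (2 : ℕ) := by
    rw [hN]; push_cast; field_simp; ring
  have e2 : 2 * (((n + 2 : ℕ) : ℝ) - 1) / (((n + 2 : ℕ) : ℝ) - 2) =
      1 / (n : ℝ) * (2 : ℕ) + (2 : ℕ) := by
    rw [hN]; push_cast; field_simp; ring
  rw [e1, e2, Real.rpow_add hB, Real.rpow_mul hA.le, Real.rpow_mul hB.le, Real.rpow_natCast,
    Real.rpow_natCast, Real.rpow_natCast]
  have e3 : ((2 : ℝ) - 1) / (((n + 2 : ℕ) : ℝ) - 2) = 1 / n := by rw [hN]; norm_num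
  rw [e3]
  have h1 := Real.rpow_pos_of_pos hA (1 / (n : ℝ))
  have h2 := Real.rpow_pos_of_pos hB (1 / (n : ℝ))
  field_simp

lemma tendsto_mul_succ_pow_sub_pow_div (n : ℕ) :
    Tendsto (fun R : ℝ => R * (((R + 1) ^ n - R ^ n) / R ^ n)) atTop (𝓝 n) := by
  have h1 : HasDerivAt (fun y : ℝ => (1 + y) ^ n) (n : ℝ) 0 := by
    have := ((hasDerivAt_id (0 : ℝ)).const_add 1).fun_pow n
    simpa using this
  have h2 := (hasDerivAt_iff_tendsto_slope_zero.1 h1).comp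
    (tendsto_inv_atTop_nhdsGT_zero.mono_right (nhdsWithin_mono _ fun y hy => ne_of_gt hy))
  refine h2.congr' ?_
  filter_upwards [eventually_gt_atTop 0] with R hR
  simp only [Function.comp, inv_inv, zero_add, add_zero, one_pow, smul_eq_mul]
  rw [sub_div, div_self (by positivity), ← div_pow]
  congr 3
  field_simp

end Laplacian

/-! ### The two limits -/

section Main

theorem eigenvalue_limits_self {N : ℕ} (hN : 2 ≤ N) :
    Tendsto (fun R : ℝ => qPlus N N R (R + 1)) atTop (𝓝 1) ∧
    Tendsto (fun R : ℝ => qMinus N N R (R + 1)) atTop (𝓝 1) ∧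
    ∃ lam : ℕ → ℝ → ℝ,
      (∀ k : ℕ, 1 ≤ k → ∀ R : ℝ, 0 < R →
        IsKthSmallest (radialSpectrum N N R (R + 1)) k (lam k R) ∧
        IsKthSmallest (weightedSpectrum N (weight N N R (R + 1))) k (lam k R)) ∧
      ∀ k : ℕ, 1 ≤ k →
        Tendsto (lam k) atTop (𝓝 ((k * piP N) ^ (N : ℝ))) ∧
        IsKthSmallest (weightedSpectrum N (fun _ => 1)) k ((k * piP N) ^ (N : ℝ)) := by
  have hN' : (2 : ℝ) ≤ N := by exact_mod_cast hN
  have hch : ∀ R > 0, RadialChange N N R (R + 1) _ _ _ _ := fun R hR =>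
    radialChange_log hN hR (lt_add_one R)
  have hL : ∀ R > (0 : ℝ), 0 < Real.log ((R + 1) / R) := fun R hR =>
    Real.log_pos ((one_lt_div hR).2 (lt_add_one R))
  have hlim : Tendsto (fun R : ℝ => (R * Real.log ((R + 1) / R)) ^ (N : ℝ)) atTop (𝓝 1) := by
    simpa using tendsto_mul_log_succ_div.rpow_const (p := (N : ℝ)) (Or.inl one_ne_zero)
  have hlim' : Tendsto (fun R : ℝ => ((R + 1) * Real.log ((R + 1) / R)) ^ (N : ℝ)) atTop
      (𝓝 1) := by
    have h1 := (tendsto_succ_div.mul tendsto_mul_log_succ_div).rpow_const (p := (N : ℝ))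
      (Or.inl (by norm_num))
    simp only [mul_one, Real.one_rpow] at h1
    refine h1.congr' ?_
    filter_upwards [eventually_gt_atTop 0] with R hR
    congr 1
    field_simp
  refine eigenvalue_limits hN' (fun R hR => ?_) (fun R hR => ?_) (fun R hR t ht => ?_)
    (fun R hR t ht => ?_) (fun R hR => ?_) hlim hlim'
  · have hx : (R + 1) / R ≠ 0 := by positivity
    simp only [funext (weight_self N R (R + 1))]
    refine Continuous.continuousOn ?_
    refine Continuous.rpow_const ?_ fun _ => Or.inr (by positivity)
    exact (continuous_const.mul (Real.continuous_const_rpow hx)).mul continuous_const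
  · have := hL R hR
    positivity
  · have := ((hch R hR).map_mem_Icc ht).1
    have := hL R hR
    rw [weight_self]
    gcongr
  · have h1 := ((hch R hR).map_mem_Icc ht).2
    have := hL R hR
    rw [weight_self]
    gcongr
  · exact (hch R hR).radialSpectrum_eq (by omega) hN' fun t _ => weight_self N R (R + 1) t

theorem eigenvalue_limits_two {n : ℕ} (hn : 1 ≤ n) :
    Tendsto (fun R : ℝ => qPlus (n + 2) 2 R (R + 1)) atTop (𝓝 1) ∧
    Tendsto (fun R : ℝ => qMinus (n + 2) 2 R (R + 1)) atTop (𝓝 1) ∧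
    ∃ lam : ℕ → ℝ → ℝ,
      (∀ k : ℕ, 1 ≤ k → ∀ R : ℝ, 0 < R →
        IsKthSmallest (radialSpectrum (n + 2) 2 R (R + 1)) k (lam k R) ∧
        IsKthSmallest (weightedSpectrum 2 (weight (n + 2) 2 R (R + 1))) k (lam k R)) ∧
      ∀ k : ℕ, 1 ≤ k →
        Tendsto (lam k) atTop (𝓝 ((k * piP 2) ^ (2 : ℝ))) ∧
        IsKthSmallest (weightedSpectrum 2 (fun _ => 1)) k ((k * piP 2) ^ (2 : ℝ)) := by
  have hn0 : (0 : ℝ) < n := by positivity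
  have hch : ∀ R > 0, RadialChange (n + 2) 2 R (R + 1) _ _ _ _ := fun R hR =>
    radialChange_pow hn hR (lt_add_one R)
  have hA : ∀ R > (0 : ℝ), 0 < coeffA (n + 2) 2 R (R + 1) := fun R hR =>
    coeffA_two_pos hn hR (lt_add_one R)
  have hbase : Tendsto (fun R : ℝ => R * (((R + 1) ^ n - R ^ n) / R ^ n) / n) atTop (𝓝 1) := by
    simpa [div_self hn0.ne'] using (tendsto_mul_succ_pow_sub_pow_div n).div_const (n : ℝ)
  have hlim : Tendsto (fun R : ℝ => (R ^ (n + 1) / (n * coeffA (n + 2) 2 R (R + 1))) ^ (2 : ℝ))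
      atTop (𝓝 1) := by
    have h1 := (hbase.mul ((tendsto_succ_div.inv₀ one_ne_zero).pow n)).rpow_const (p := (2 : ℝ))
      (Or.inl (by norm_num))
    simp only [inv_one, one_pow, mul_one, Real.one_rpow] at h1
    refine h1.congr' ?_
    filter_upwards [eventually_gt_atTop 0] with R hR
    have hD : 0 < (R + 1) ^ n - R ^ n := by
      rw [sub_pos]; gcongr; linarith
    congr 1
    rw [coeffA_two, mul_pow, inv_div, div_pow]
    field_simp
    ring
  have hlim' : Tendsto
      (fun R : ℝ => ((R + 1) ^ (n + 1) / (n * coeffA (n + 2) 2 R (R + 1))) ^ (2 : ℝ))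
      atTop (𝓝 1) := by
    have h1 := (hbase.mul tendsto_succ_div).rpow_const (p := (2 : ℝ)) (Or.inl (by norm_num))
    simp only [mul_one, Real.one_rpow] at h1
    refine h1.congr' ?_
    filter_upwards [eventually_gt_atTop 0] with R hR
    have hD : 0 < (R + 1) ^ n - R ^ n := by
      rw [sub_pos]; gcongr; linarith
    congr 1
    rw [coeffA_two, mul_pow]
    field_simp
    ring
  refine eigenvalue_limits le_rfl (fun R hR => ?_) (fun R hR => ?_) (fun R hR t ht => ?_)
    (fun R hR t ht => ?_) (fun R hR => ?_) hlim hlim'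
  · refine ContinuousOn.congr ?_ fun t ht => weight_two hn hR (lt_add_one R) ht.2
    refine ContinuousOn.rpow_const ?_ fun _ _ => Or.inr zero_le_two
    refine ContinuousOn.div_const (ContinuousOn.pow ?_ _) _
    exact fun t ht =>
      (hasDerivAt_powRadius hn hR (lt_add_one R) ht.2).continuousAt.continuousWithinAt
  · have := hA R hR
    positivity
  · have := ((hch R hR).map_mem_Icc ht).1
    have := hA R hR
    rw [weight_two hn hR (lt_add_one R) ht.2]
    gcongr
  · have h1 := ((hch R hR).map_mem_Icc ht)
    have := hA R hR
    have := hR.trans_le h1.1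
    have := h1.2
    rw [weight_two hn hR (lt_add_one R) ht.2]
    gcongr
  · exact (hch R hR).radialSpectrum_eq (by omega) le_rfl fun t ht =>
      weight_two hn hR (lt_add_one R) ht.2.le

lemma piP_two : piP 2 = Real.pi := by
  rw [piP, Real.sin_pi_div_two]
  norm_num

end Main

end AnnularEigenvalues

end

open AnnularEigenvalues in
theorem theorem1p2 :
    (∀ N : ℕ, 2 ≤ N →
      Tendsto (fun R : ℝ => qPlus N N R (R + 1)) atTop (𝓝 1) ∧
      Tendsto (fun R : ℝ => qMinus N N R (R + 1)) atTop (𝓝 1) ∧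
      ∃ lam : ℕ → ℝ → ℝ,
        (∀ k : ℕ, 1 ≤ k → ∀ R : ℝ, 0 < R →
          IsKthSmallest (radialSpectrum N N R (R + 1)) k (lam k R) ∧
          IsKthSmallest (weightedSpectrum N (weight N N R (R + 1))) k (lam k R)) ∧
        ∀ k : ℕ, 1 ≤ k →
          Tendsto (lam k) atTop (𝓝 ((k * piP N) ^ (N : ℝ))) ∧
          IsKthSmallest (weightedSpectrum N (fun _ => 1)) k ((k * piP N) ^ (N : ℝ))) ∧
    (∀ N : ℕ, 3 ≤ N →
      Tendsto (fun R : ℝ => qPlus N 2 R (R + 1)) atTop (𝓝 1) ∧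
      Tendsto (fun R : ℝ => qMinus N 2 R (R + 1)) atTop (𝓝 1) ∧
      ∃ lam : ℕ → ℝ → ℝ,
        (∀ k : ℕ, 1 ≤ k → ∀ R : ℝ, 0 < R →
          IsKthSmallest (radialSpectrum N 2 R (R + 1)) k (lam k R) ∧
          IsKthSmallest (weightedSpectrum 2 (weight N 2 R (R + 1))) k (lam k R)) ∧
        ∀ k : ℕ, 1 ≤ k →
          Tendsto (lam k) atTop (𝓝 ((k * Real.pi) ^ 2)) ∧
          IsKthSmallest (weightedSpectrum 2 (fun _ => 1)) k ((k * Real.pi) ^ 2)) := by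
  
  refine ⟨fun N hN => eigenvalue_limits_self hN, fun N hN => ?_⟩
  obtain ⟨n, rfl⟩ : ∃ n, N = n + 2 := ⟨N - 2, by omega⟩
  have h := eigenvalue_limits_two (n := n) (by omega)
  rw [piP_two] at h
  simpa only [Real.rpow_two] using h
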